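/- Let $k$ be a field of characteristic $0$. A fusion category over $k$ is a $k$-linear abelian semisimple category with finite-dimensional morphism spaces and finitely many simple objects up to isomorphism, with a $k$-bilinear rigid monoidal structure whose neutral object is simple, such that $\mathrm{End}(a)=k$ for every simple object $a$. A fusion system $(L,N,F)$ over $k$ consists of a finite set $L$ with a distinguished element $\mathbf 1$, an involution $a\mapsto a^*$ of $L$ with $\mathbf 1^*=\mathbf 1$, non-negative integers $N_{ab}^c$ ($a,b,c\in L$) with $$N_{\mathbf 1 a}^b=\delta_{ab}=N_{a\mathbf 1}^b,\qquad N_{ab}^{\mathbf 1}=\delta_{a^*b},\qquad \sum_e N_{ab}^eN_{ec}^u=\sum_{e}N_{ae}^uN_{bc}^{e},$$ and invertible matrices $F_{abc}^u$ over $k$, with entries $F_{abc}^u\left[\begin{smallmatrix} i&e&j\\ i'&e'&j'\end{smallmatrix}\right]$ indexed by $e,e'\in L$, $i\le N_{ab}^e$, $j\le N_{ec}^u$, $i'\le N_{ae'}^u$, $j'\le N_{bc}^{e'}$, such that $F_{a\mathbf 1 b}^u$ is the identity matrix, $F_{aa^*a}^a\left[\begin{smallmatrix}1&\mathbf 1&1\\1&\mathbf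 1&1\end{smallmatrix}\right]\ne 0$, and, for all admissible indices, $$\sum_{l}F_{ecd}^u\left[\begin{smallmatrix} j&f&k\\ l&g&m\end{smallmatrix}\right]F_{abg}^u\left[\begin{smallmatrix} i&e&l\\ n&h&o\end{smallmatrix}\right]=\sum_{q,p,r,v}F_{abc}^f\left[\begin{smallmatrix} i&e&j\\ p&q&r\end{smallmatrix}\right]F_{aqd}^u\left[\begin{smallmatrix} p&f&k\\ n&h&v\end{smallmatrix}\right]F_{bcd}^h\left[\begin{smallmatrix} r&q&v\\ o&g&m\end{smallmatrix}\right].$$ For a fusion system $(L,N,F)$ over $k$, let $\mathcal C(L,N,F)$ be the following category. Objects are functions $f:L\to\mathbb N$; morphisms $f\to g$ are families $(A(a))_{a\in L}$ of $g(a)\times f(a)$ matrices over $k$, composed by matrix multiplication. Put $(f\otimes g)(c)=\sum_{a,b}f(a)g(b)N_{ab}^c$ and $(A\otimes B)(c)=\bigoplus_{a,b}A(a)\otimes B(b)\otimes I_{N_{ab}^c}$ (basis labels in lexicographic order for a fixed order on $L$). The neutral object is $\delta_{\mathbf 1}$, the unit isomorphisms are identities, and the associativity isomorphism $f\otimes(g\otimes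 h)\to(f\otimes g)\otimes h$ is the additive extension of $\alpha_{a,b,c}=(F_{abc}^u)_{u\in L}$ on the simple objects $a=\delta_a$. Then: (1) $\mathcal C(L,N,F)$ is a skeletal, strictly unital fusion category over $k$. (2) Let $\mathcal C$ be a fusion category over $k$. There is a choice of: a set $L$ of representatives of the isomorphism classes of simple objects containing the neutral object $\mathbf 1$; for each $a\in L$ a right dual $a^*\in L$ with an evaluation $e_a:a\otimes a^*\to\mathbf 1$; and bases $\{\eta_{ab}^{c,i}\}_{i\le N_{ab}^c}$ of all spaces $\mathcal C(a\otimes b,c)$ with $\eta_{\mathbf 1a}^{a,1}=\lambda_a$, $\eta_{a\mathbf 1}^{a,1}=\rho_a$, $\eta_{aa^*}^{\mathbf 1,1}=e_a$, where $\lambda,\rho$ are the unit isomorphisms. For every such choice the equations $$\eta_{ec}^{u,j}\circ(\eta_{ab}^{e,i}\otimes 1_c)\circ\alpha_{a,b,c}=\sum_{e',i',j'}F_{abc}^u\left[\begin{smallmatrix} i&e&j\\ i'&e'&j'\end{smallmatrix}\right]\,\eta_{ae'}^{u,i'}\circ(1_a\otimes\eta_{bc}^{e',j'}),$$ with $\alpha_{a,b,c}:a\otimes(b\otimes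 c)\to(a\otimes b)\otimes c$ the associativity isomorphism of $\mathcal C$, have a unique solution $F$; $(L,N,F)$ is a fusion system; and there is a $k$-linear monoidal equivalence $\mathcal C(L,N,F)\simeq\mathcal C$. -/

import Mathlib

open CategoryTheory MonoidalCategory
open scoped Kronecker

universe t u v w

noncomputable section

/-! ## Fusion categories -/

/-- A fusion category over a field `k`: a `k`-linear abelian category, semisimple with finitely many
simple objects up to isomorphism and finite-dimensional morphism spaces, with a `k`-bilinear rigid
monoidal structure whose unit object is simple, such that `End(X) = k` for every simple `X`. -/
structure IsFusionCategory (k : Type t) [Field k] (C : Type u) [Category.{v} C] [Preadditive C]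
    [Linear k C] [MonoidalCategory C] : Prop where
  abelian : ∃ ab : Abelian C, ab.toPreadditive = ‹Preadditive C›
  finite_hom : ∀ X Y : C, Module.Finite k (X ⟶ Y)
  monoidalPreadditive : MonoidalPreadditive C
  monoidalLinear : MonoidalLinear k C
  rigid : Nonempty (RigidCategory C)
  /-- every object is a finite direct sum of simple objects -/
  semisimple : ∀ X : C, ∃ (n : ℕ) (s : Fin n → C), (∀ i, Simple (s i)) ∧
    ∃ b : Limits.Bicone s, Nonempty b.IsBilimit ∧ Nonempty (X ≅ b.pt)
  finite_simple : ∃ (n : ℕ) (s : Fin n → C), ∀ X : C, Simple X → ∃ i, Nonempty (X ≅ s i)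
  unit_simple : Simple (𝟙_ C)
  /-- scalars identify `k` with the endomorphism space of a simple object -/
  end_simple : ∀ X : C, Simple X → Function.Bijective (fun r : k => r • 𝟙 X)

/-- The unit object is a strict unit: `𝟙 ⊗ X = X = X ⊗ 𝟙`, and both unitors are identities. -/
def IsStrictlyUnital (C : Type u) [Category.{v} C] [MonoidalCategory C] : Prop :=
  ∀ X : C, (∃ h : 𝟙_ C ⊗ X = X, (λ_ X).hom = eqToHom h) ∧
    (∃ h : X ⊗ 𝟙_ C = X, (ρ_ X).hom = eqToHom h)

/-! ## Fusion systems -/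

/-- A finite set of labels with a distinguished label, a unary operation `a ↦ a*` and
multiplicities `N a b c = N_{ab}^c`; no equations are imposed yet. -/
structure FusionRuleData where
  L : Type w
  [fintype : Fintype L]
  [decEq : DecidableEq L]
  one : L
  star : L → L
  N : L → L → L → ℕ

attribute [instance] FusionRuleData.fintype FusionRuleData.decEq

namespace FusionRuleData

variable (R : FusionRuleData.{w})

/-- The row labels `(i, e, j)` of `F_{abc}^u`, with `i ≤ N_{ab}^e` and `j ≤ N_{ec}^u`. -/
abbrev Row (a b c u : R.L) : Type w := Σ e : R.L, Fin (R.N a b e) × Fin (R.N e c u)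

/-- The column labels `(i', e', j')` of `F_{abc}^u`, with `i' ≤ N_{ae'}^u` and `j' ≤ N_{bc}^{e'}`. -/
abbrev Col (a b c u : R.L) : Type w := Σ e : R.L, Fin (R.N a e u) × Fin (R.N b c e)

/-- A family of matrices `F_{abc}^u` with entries in `k`. -/
abbrev FMatrices (k : Type t) : Type (max t w) :=
  ∀ a b c u : R.L, Matrix (R.Row a b c u) (R.Col a b c u) k

variable {R} in
/-- The entry `F_{abc}^u [i e j; i' e' j']`. -/
abbrev FMatrices.entry {k : Type t} (F : R.FMatrices k) {a b c u : R.L}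
    {e : R.L} (i : Fin (R.N a b e)) (j : Fin (R.N e c u))
    {e' : R.L} (i' : Fin (R.N a e' u)) (j' : Fin (R.N b c e')) : k :=
  F a b c u ⟨e, i, j⟩ ⟨e', i', j'⟩

/-- The axioms of a fusion system `(L, N, F)` over `k`. In `triangle` and `duality` the quantified
indices that are not named in the equation run over one-element sets, by `N_one_left`,
`N_one_right` and `N_dual`. -/
structure IsFusionSystem {k : Type t} [Field k] (F : R.FMatrices k) : Prop where
  star_star : ∀ a, R.star (R.star a) = a
  star_one : R.star R.one = R.one
  N_one_left : ∀ a b, R.N R.one a b = if a = b then 1 else 0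
  N_one_right : ∀ a b, R.N a R.one b = if a = b then 1 else 0
  N_dual : ∀ a b, R.N a b R.one = if R.star a = b then 1 else 0
  N_assoc : ∀ a b c u, ∑ e, R.N a b e * R.N e c u = ∑ e, R.N a e u * R.N b c e
  invertible : ∀ a b c u, ∃ G : Matrix (R.Col a b c u) (R.Row a b c u) k,
    F a b c u * G = 1 ∧ G * F a b c u = 1
  /-- `F_{a1b}^u` is the identity matrix -/
  triangle : ∀ (a b u : R.L) (i : Fin (R.N a R.one a)) (j : Fin (R.N a b u))
    (i' : Fin (R.N a b u)) (j' : Fin (R.N R.one b b)),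
    F.entry i j i' j' = if j = i' then 1 else 0
  /-- `u_a := F_{a a* a}^a [1 1 1; 1 1 1]` is non-zero -/
  duality : ∀ (a : R.L) (i : Fin (R.N a (R.star a) R.one)) (j : Fin (R.N R.one a a))
    (i' : Fin (R.N a R.one a)) (j' : Fin (R.N (R.star a) a R.one)),
    F.entry i j i' j' ≠ 0
  pentagon : ∀ (a b c d u e f g h : R.L) (i : Fin (R.N a b e)) (j : Fin (R.N e c f))
    (k : Fin (R.N f d u)) (n : Fin (R.N a h u)) (o : Fin (R.N b g h)) (m : Fin (R.N c d g)),
    ∑ l : Fin (R.N e g u), F.entry j k l m * F.entry i l n o =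
      ∑ q : R.L, ∑ p : Fin (R.N a q f), ∑ r : Fin (R.N b c q), ∑ v : Fin (R.N q d h),
        F.entry i j p r * F.entry p k n v * F.entry r v o m

end FusionRuleData

/-- A fusion system `(L, N, F)` over `k`. -/
structure FusionSystem (k : Type t) [Field k] where
  R : FusionRuleData.{w}
  F : R.FMatrices k
  isFusionSystem : R.IsFusionSystem F

/-! ## The category built from a fusion system -/

namespace FusionSystem

variable {k : Type t} [Field k] (S : FusionSystem.{t, w} k)

/-- The set of labels. -/
abbrev L : Type w := S.R.L

/-- The multiplicities. -/
abbrev N : S.L → S.L → S.L → ℕ := S.R.N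

/-- Objects of `C(L, N, F)` are functions `L → ℕ`. -/
@[ext]
structure Obj : Type w where
  mult : S.L → ℕ

variable {S}

instance : CoeFun S.Obj (fun _ => S.L → ℕ) := ⟨Obj.mult⟩

/-- Morphisms `f ⟶ g` are families of `g(a) × f(a)` matrices, composed by matrix multiplication:
`C(L, N, F)` is the product over `L` of skeletal categories of finite-dimensional spaces. -/
instance : Category.{max w t} S.Obj where
  Hom f g := ∀ a : S.L, Matrix (Fin (g a)) (Fin (f a)) k
  id _ := fun _ => 1
  comp A B := fun a => B a * A a
  id_comp A := funext fun a => Matrix.mul_one (A a)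
  comp_id A := funext fun a => Matrix.one_mul (A a)
  assoc A B C := funext fun a => (Matrix.mul_assoc (C a) (B a) (A a)).symm

instance : Preadditive S.Obj where
  homGroup f g := inferInstanceAs (AddCommGroup (∀ a : S.L, Matrix (Fin (g a)) (Fin (f a)) k))
  add_comp _ _ _ A A' B := funext fun a => Matrix.mul_add (B a) (A a) (A' a)
  comp_add _ _ _ A B B' := funext fun a => Matrix.add_mul (B a) (B' a) (A a)

instance : Linear k S.Obj where
  homModule f g := inferInstanceAs (Module k (∀ a : S.L, Matrix (Fin (g a)) (Fin (f a)) k))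
  smul_comp _ _ _ r A B := funext fun a => Matrix.mul_smul (B a) r (A a)
  comp_smul _ _ _ A r B := funext fun a => Matrix.smul_mul r (B a) (A a)

/-- The family of matrices underlying a morphism. -/
def Obj.mat {f g : S.Obj} (A : f ⟶ g) (a : S.L) : Matrix (Fin (g a)) (Fin (f a)) k := A a

/-- The labels of the basis of the `c`-component of `f ⊗ g`: pairs `(a, b)` of labels with positions
in `f a`, in `g b` and in `N_{ab}^c`. -/
abbrev TIdx (f g : S.Obj) (c : S.L) : Type w :=
  Σ p : S.L × S.L, Fin (f p.1) × Fin (g p.2) × Fin (S.N p.1 p.2 c)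

/-- Numerical coordinates of a basis label, with respect to a fixed enumeration of `L`. -/
def TIdx.key {f g : S.Obj} {c : S.L} (x : TIdx f g c) : ℕ ×ₗ ℕ ×ₗ ℕ ×ₗ ℕ ×ₗ ℕ :=
  toLex ((Fintype.equivFin S.L x.1.1 : ℕ), toLex ((Fintype.equivFin S.L x.1.2 : ℕ),
    toLex ((x.2.1 : ℕ), toLex ((x.2.2.1 : ℕ), (x.2.2.2 : ℕ)))))

theorem TIdx.key_injective {f g : S.Obj} {c : S.L} :
    Function.Injective (TIdx.key : TIdx f g c → _) := by
  rintro ⟨⟨a, b⟩, m, n, i⟩ ⟨⟨a', b'⟩, m', n', i'⟩ h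
  simp only [TIdx.key, EmbeddingLike.apply_eq_iff_eq, Prod.mk.injEq, Fin.val_inj] at h
  obtain ⟨ha, hb, hm, hn, hi⟩ := h
  obtain rfl : a = a' := ha
  obtain rfl : b = b' := hb
  rw [Fin.ext hm, Fin.ext hn, Fin.ext hi]

/-- The lexicographic order on basis labels. -/
@[reducible] def TIdx.linearOrder (f g : S.Obj) (c : S.L) : LinearOrder (TIdx f g c) :=
  LinearOrder.lift' TIdx.key TIdx.key_injective

/-- `(f ⊗ g)(c) = ∑_{a, b} f(a) g(b) N_{ab}^c`. -/
def tensObj (f g : S.Obj) : S.Obj where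
  mult c := ∑ p : S.L × S.L, f p.1 * (g p.2 * S.N p.1 p.2 c)

theorem card_tIdx (f g : S.Obj) (c : S.L) : Fintype.card (TIdx f g c) = tensObj f g c := by
  simp [tensObj, TIdx]

/-- The identification of `{1, …, (f ⊗ g)(c)}` with the set of basis labels, in lexicographic
order. -/
def idx (f g : S.Obj) (c : S.L) : Fin (tensObj f g c) ≃ TIdx f g c :=
  (@Fintype.orderIsoFinOfCardEq (TIdx f g c) (TIdx.linearOrder f g c) _ _
    (card_tIdx f g c)).toEquiv

/-- `(A ⊗ B)(c) = ⊕_{a, b} A(a) ⊗ B(b) ⊗ I_{N_{ab}^c}`. -/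
def tensHom {f f' g g' : S.Obj} (A : f ⟶ f') (B : g ⟶ g') : tensObj f g ⟶ tensObj f' g' :=
  fun c => (Matrix.blockDiagonal' fun p : S.L × S.L =>
    Obj.mat A p.1 ⊗ₖ (Obj.mat B p.2 ⊗ₖ (1 : Matrix (Fin (S.N p.1 p.2 c)) (Fin (S.N p.1 p.2 c)) k))
    ).submatrix (idx f' g' c) (idx f g c)

/-- The simple object `δ_a`. -/
def delta (a : S.L) : S.Obj := ⟨fun b => if a = b then 1 else 0⟩

/-- The neutral object `δ_1`. -/
def unitObj : S.Obj := delta S.R.one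

theorem unit_tensObj (f : S.Obj) : tensObj unitObj f = f := by
  ext c
  simp [tensObj, unitObj, delta, Fintype.sum_prod_type, N, S.isFusionSystem.N_one_left]

theorem tensObj_unit (f : S.Obj) : tensObj f unitObj = f := by
  ext c
  simp [tensObj, unitObj, delta, Fintype.sum_prod_type, N, S.isFusionSystem.N_one_right]

/-- The `u`-component of `(f ⊗ g) ⊗ h` is indexed by triples `(a, b, c)` of labels, with positions
in `f a`, `g b`, `h c` and a row label of `F_{abc}^u`. -/
def idxLeft (f g h : S.Obj) (u : S.L) : Fin (tensObj (tensObj f g) h u) ≃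
    Σ p : S.L × S.L × S.L, (Fin (f p.1) × Fin (g p.2.1) × Fin (h p.2.2)) ×
      S.R.Row p.1 p.2.1 p.2.2 u :=
  (idx (tensObj f g) h u).trans <|
  (Equiv.sigmaCongrRight fun p : S.L × S.L =>
    (Equiv.prodCongr (idx f g p.1) (Equiv.refl (Fin (h p.2) × Fin (S.N p.1 p.2 u))))).trans
  { toFun := fun x => ⟨(x.2.1.1.1, x.2.1.1.2, x.1.2),
      (x.2.1.2.1, x.2.1.2.2.1, x.2.2.1), ⟨x.1.1, x.2.1.2.2.2, x.2.2.2⟩⟩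
    invFun := fun y => ⟨(y.2.2.1, y.1.2.2),
      ⟨(y.1.1, y.1.2.1), y.2.1.1, y.2.1.2.1, y.2.2.2.1⟩, y.2.1.2.2, y.2.2.2.2⟩
    left_inv := fun _ => rfl
    right_inv := fun _ => rfl }

/-- The `u`-component of `f ⊗ (g ⊗ h)` is indexed by triples `(a, b, c)` of labels, with positions
in `f a`, `g b`, `h c` and a column label of `F_{abc}^u`. -/
def idxRight (f g h : S.Obj) (u : S.L) : Fin (tensObj f (tensObj g h) u) ≃
    Σ p : S.L × S.L × S.L, (Fin (f p.1) × Fin (g p.2.1) × Fin (h p.2.2)) ×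
      S.R.Col p.1 p.2.1 p.2.2 u :=
  (idx f (tensObj g h) u).trans <|
  (Equiv.sigmaCongrRight fun p : S.L × S.L =>
    (Equiv.prodCongr (Equiv.refl (Fin (f p.1)))
      (Equiv.prodCongr (idx g h p.2) (Equiv.refl (Fin (S.N p.1 p.2 u)))))).trans
  { toFun := fun x => ⟨(x.1.1, x.2.2.1.1.1, x.2.2.1.1.2),
      (x.2.1, x.2.2.1.2.1, x.2.2.1.2.2.1), ⟨x.1.2, x.2.2.2, x.2.2.1.2.2.2⟩⟩
    invFun := fun y => ⟨(y.1.1, y.2.2.1),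
      y.2.1.1, ⟨(y.1.2.1, y.1.2.2), y.2.1.2.1, y.2.1.2.2, y.2.2.2.2⟩, y.2.2.2.1⟩
    left_inv := fun _ => rfl
    right_inv := fun _ => rfl }

/-- The inverse of the matrix `F_{abc}^u`. -/
def Finv (a b c u : S.L) : Matrix (S.R.Col a b c u) (S.R.Row a b c u) k :=
  (S.isFusionSystem.invertible a b c u).choose

/-- The associativity isomorphism `f ⊗ (g ⊗ h) ≅ (f ⊗ g) ⊗ h`: on simple objects it is given by the
matrices `F_{abc}^u`, and it is extended additively to all objects. -/
def assocIso (f g h : S.Obj) :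
    tensObj f (tensObj g h) ≅ tensObj (tensObj f g) h where
  hom := fun u => (Matrix.blockDiagonal' fun p : S.L × S.L × S.L =>
    (1 : Matrix (Fin (f p.1) × Fin (g p.2.1) × Fin (h p.2.2)) _ k) ⊗ₖ S.F p.1 p.2.1 p.2.2 u
    ).submatrix (idxLeft f g h u) (idxRight f g h u)
  inv := fun u => (Matrix.blockDiagonal' fun p : S.L × S.L × S.L =>
    (1 : Matrix (Fin (f p.1) × Fin (g p.2.1) × Fin (h p.2.2)) _ k) ⊗ₖ Finv p.1 p.2.1 p.2.2 u
    ).submatrix (idxRight f g h u) (idxLeft f g h u)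
  hom_inv_id := by
    funext u
    refine (Matrix.submatrix_mul_equiv _ _ _ _ _).trans ?_
    rw [← Matrix.blockDiagonal'_mul]
    simp only [← Matrix.mul_kronecker_mul, Finv,
      (S.isFusionSystem.invertible _ _ _ _).choose_spec.2, Matrix.mul_one,
      Matrix.one_kronecker_one]
    exact (congrArg (fun M => Matrix.submatrix M _ _) Matrix.blockDiagonal'_one).trans
      (Matrix.submatrix_one_equiv _)
  inv_hom_id := by
    funext u
    refine (Matrix.submatrix_mul_equiv _ _ _ _ _).trans ?_
    rw [← Matrix.blockDiagonal'_mul]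
    simp only [← Matrix.mul_kronecker_mul, Finv,
      (S.isFusionSystem.invertible _ _ _ _).choose_spec.1, Matrix.mul_one,
      Matrix.one_kronecker_one]
    exact (congrArg (fun M => Matrix.submatrix M _ _) Matrix.blockDiagonal'_one).trans
      (Matrix.submatrix_one_equiv _)

variable (S)

/-- The tensor product, neutral object, associativity and unit isomorphisms of `C(L, N, F)`, as data.
The associator of Mathlib goes from `(f ⊗ g) ⊗ h` to `f ⊗ (g ⊗ h)`. -/
@[reducible] def monoidalStruct : MonoidalCategoryStruct S.Obj where
  tensorObj := tensObj
  tensorHom A B := tensHom A B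
  whiskerLeft f _ _ B := tensHom (𝟙 f) B
  whiskerRight A g := tensHom A (𝟙 g)
  tensorUnit := unitObj
  associator f g h := (assocIso f g h).symm
  leftUnitor f := eqToIso (unit_tensObj f)
  rightUnitor f := eqToIso (tensObj_unit f)

end FusionSystem

/-! ## Extraction of a fusion system from a fusion category -/

/-- The choices from which a fusion system is extracted from `C`: representatives `X a` of the
isomorphism classes of simple objects, one of which is the neutral object, for each `a` a right dual
`X (a*)` with evaluation `X a ⊗ X (a*) ⟶ 𝟙`, and a basis `η_{ab}^{c,i}` of every morphism space
`X a ⊗ X b ⟶ X c`, containing the left unitors, the right unitors and the evaluations. -/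
structure FusionGauge (k : Type t) [Field k] (C : Type u) [Category.{v} C] [Preadditive C]
    [Linear k C] [MonoidalCategory C] (R : FusionRuleData.{w}) where
  X : R.L → C
  simple : ∀ a, Simple (X a)
  eq_of_iso : ∀ a b, Nonempty (X a ≅ X b) → a = b
  exists_iso : ∀ Y : C, Simple Y → ∃ a, Nonempty (Y ≅ X a)
  X_one : X R.one = 𝟙_ C
  pairing : ∀ a, ExactPairing (X (R.star a)) (X a)
  η : ∀ a b c, Module.Basis (Fin (R.N a b c)) k (X a ⊗ X b ⟶ X c)
  η_left : ∀ a i, η R.one a a i = eqToHom X_one ▷ X a ≫ (λ_ (X a)).hom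
  η_right : ∀ a i, η a R.one a i = X a ◁ eqToHom X_one ≫ (ρ_ (X a)).hom
  η_eval : ∀ a i, η a (R.star a) R.one i ≫ eqToHom X_one = (pairing a).evaluation'

/-- `F_{abc}^u` is the matrix of precomposition with the associator
`X a ⊗ (X b ⊗ X c) ⟶ (X a ⊗ X b) ⊗ X c` in the bases induced by the chosen ones. -/
def FusionGauge.Extracts {k : Type t} [Field k] {C : Type u} [Category.{v} C] [Preadditive C]
    [Linear k C] [MonoidalCategory C] {R : FusionRuleData.{w}} (G : FusionGauge k C R)
    (F : R.FMatrices k) : Prop :=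
  ∀ (a b c u e : R.L) (i : Fin (R.N a b e)) (j : Fin (R.N e c u)),
    (α_ (G.X a) (G.X b) (G.X c)).inv ≫ (G.η a b e i ▷ G.X c) ≫ G.η e c u j =
      ∑ e' : R.L, ∑ i' : Fin (R.N a e' u), ∑ j' : Fin (R.N b c e'),
        F.entry i j i' j' • ((G.X a ◁ G.η b c e' j') ≫ G.η a e' u i')

end

/-!
Everything is done with covectors. A morphism `A : f ⟶ g` of `C(L, N, F)` is the same as a family of
linear maps `k^{g(a)} → k^{f(a)}` (`FusionSystem.act`), and covectors `v` of `f(a)`, `w` of `g(b)`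
together with a label `i ≤ N_{ab}^c` give a covector `tens a b c i v w` of `(f ⊗ g)(c)`. These span.
The tensor product of morphisms acts by `tens v w ↦ tens (A v) (B w)` (`act_tensHom`), the
associativity isomorphism acts on iterated tensors by the matrices `F` (`act_assoc`), and the unit
isomorphisms, which are identities of matrices because the basis labels are ordered
lexicographically, insert the covector of the neutral object (`act_leftUnitor`, `act_rightUnitor`).
In these terms naturality is evident, and the pentagon and triangle axioms are the pentagon and
triangle equations for `F`, up to the order of summation.

The category is semisimple with simple objects `δ_a`. That `δ_{a*}` is dual to `δ_a` comes from the
computation `IsSimpleFamily.zigzag_eq`: the zigzag of `η_{a a*}^1` with a section of `η_{a* a}^1` is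
the scalar `F_{a a* a}^a [1 1 1; 1 1 1] ≠ 0`. The other zigzag identity is then automatic, since an
endomorphism of a simple object that fixes a non-zero evaluation is the identity
(`exactPairingOfZigzag`). Direct sums of objects with duals have duals (`exactPairingOfSum`).

For a fusion category `C` with simple objects `X a`, the main tool is that morphisms `Y ⟶ Z`
correspond to families of linear maps `Hom(Z, X a) → Hom(Y, X a)` (`IsSimpleFamily.hom_ext`,
`IsSimpleFamily.homOf`), together with its consequence `IsSimpleFamily.exists_basis_comp` that bases
of such spaces of morphisms can be composed. Hence the composites of the `η_{ab}^{c,i}` form bases of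
`Hom((X a ⊗ X b) ⊗ X c, X u)` and `Hom(X a ⊗ (X b ⊗ X c), X u)`, and `F` is the matrix of a change of
basis. The pentagon equation is obtained by expanding both sides of the pentagon of `C` in a basis of
`Hom(X a ⊗ (X b ⊗ (X c ⊗ X d)), X u)`; the same zigzag computation as before shows that
`F_{a a* a}^a [1 1 1; 1 1 1] ≠ 0`; and `a** = a` because `Hom(1, a* ⊗ a) ≠ 0` implies
`Hom(a* ⊗ a, 1) ≠ 0` in a semisimple category.

The equivalence `FusionGauge.realize` maps `f` to `⊕_a f(a) X a`, whose morphisms to `X a` are the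
covectors of `f(a)`. Its tensor constraint is the isomorphism that sends `tens a b c i v w` to
`(v ⊗ w) ≫ η_{ab}^{c,i}`. On covectors, its compatibility with associativity is the equation that
defines `F`.
-/

noncomputable section

/-! ### Covectors and the tensor product of `C(L, N, F)` -/

namespace FusionSystem

variable {k : Type t} [Field k] {S : FusionSystem.{t, w} k}

/-- Covectors of the `a`-component of an object. -/
abbrev Cov (f : S.Obj) (a : S.L) : Type t := Fin (f a) → k

/-- The action of a morphism on covectors, by multiplication with matrices from the right. It is
contravariant. -/
def act {f g : S.Obj} (A : f ⟶ g) (a : S.L) : Cov g a →ₗ[k] Cov f a :=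
  (Obj.mat A a).vecMulLinear

theorem act_single {f g : S.Obj} (A : f ⟶ g) (a : S.L) (m : Fin (g a)) :
    act A a (Pi.single m 1) = Obj.mat A a m := by
  simp only [act, Matrix.vecMulLinear_apply, Matrix.single_one_vecMul]
  rfl

@[simp] theorem act_id (f : S.Obj) (a : S.L) : act (𝟙 f) a = LinearMap.id := by
  ext m x
  exact congrFun (congrFun (congrArg DFunLike.coe (LinearMap.ext fun v =>
    Matrix.vecMul_one v : (1 : Matrix (Fin (f a)) (Fin (f a)) k).vecMulLinear = LinearMap.id))
      (Pi.single m 1)) x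

@[simp] theorem act_comp {f g h : S.Obj} (A : f ⟶ g) (B : g ⟶ h) (a : S.L) :
    act (A ≫ B) a = act A a ∘ₗ act B a := by
  refine LinearMap.ext fun v => ?_
  exact (Matrix.vecMul_vecMul v (Obj.mat B a) (Obj.mat A a)).symm

theorem act_comp_apply {f g h : S.Obj} (A : f ⟶ g) (B : g ⟶ h) (a : S.L) (v : Cov h a) :
    act (A ≫ B) a v = act A a (act B a v) := by
  rw [act_comp]; rfl

theorem act_add {f g : S.Obj} (A B : f ⟶ g) (a : S.L) : act (A + B) a = act A a + act B a :=
  LinearMap.ext fun v => Matrix.vecMul_add (Obj.mat A a) (Obj.mat B a) v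

theorem act_smul {f g : S.Obj} (r : k) (A : f ⟶ g) (a : S.L) : act (r • A) a = r • act A a :=
  LinearMap.ext fun v => Matrix.vecMul_smul v r (Obj.mat A a)

theorem act_zero {f g : S.Obj} (a : S.L) : act (0 : f ⟶ g) a = 0 :=
  LinearMap.ext fun v => Matrix.vecMul_zero v

theorem hom_ext {f g : S.Obj} {A B : f ⟶ g} (h : ∀ a, act A a = act B a) : A = B := by
  refine funext fun a => Matrix.ext fun m n => ?_
  have := congrArg (fun φ : Cov g a →ₗ[k] Cov f a => φ (Pi.single m 1) n) (h a)
  rw [act_single, act_single] at this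
  exact this

/-- The morphism with a prescribed action on covectors. -/
def ofAct {f g : S.Obj} (θ : ∀ a, Cov g a →ₗ[k] Cov f a) : f ⟶ g :=
  fun a => Matrix.of fun m => θ a (Pi.single m 1)

@[simp] theorem act_ofAct {f g : S.Obj} (θ : ∀ a, Cov g a →ₗ[k] Cov f a) (a : S.L) :
    act (ofAct θ) a = θ a := by
  refine LinearMap.pi_ext' fun m => LinearMap.ext_ring ?_
  exact act_single _ _ _

theorem act_isIso_bijective {f g : S.Obj} (e : f ≅ g) (a : S.L) :
    Function.Bijective (act e.hom a) := by
  refine Function.bijective_iff_has_inverse.2 ⟨act e.inv a, fun v => ?_, fun v => ?_⟩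
  · rw [← act_comp_apply, e.inv_hom_id, act_id]; rfl
  · rw [← act_comp_apply, e.hom_inv_id, act_id]; rfl

/-- The coordinate covector of the basis label `x` of a tensor product. -/
def lab {f g : S.Obj} {c : S.L} (x : TIdx f g c) : Cov (tensObj f g) c :=
  Pi.single ((idx f g c).symm x) 1

/-- Covectors `v` of `f a`, `w` of `g b` and a label `i ≤ N_{ab}^c` give a covector of `(f ⊗ g) c`:
the composite `(v ⊗ w) ≫ η_{ab}^{c,i}`. -/
def tens {f g : S.Obj} (a b c : S.L) (i : Fin (S.N a b c)) :
    Cov f a →ₗ[k] Cov g b →ₗ[k] Cov (tensObj f g) c :=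
  LinearMap.mk₂ k (fun v w => ∑ m, ∑ n, (v m * w n) • lab ⟨(a, b), m, n, i⟩)
    (fun v v' w => by simp [add_mul, add_smul, Finset.sum_add_distrib])
    (fun r v w => by simp [mul_smul, Finset.smul_sum])
    (fun v w w' => by simp [mul_add, add_smul, Finset.sum_add_distrib])
    (fun r v w => by simp [mul_smul, Finset.smul_sum, mul_left_comm])

theorem tens_apply {f g : S.Obj} (a b c : S.L) (i : Fin (S.N a b c)) (v : Cov f a) (w : Cov g b) :
    tens a b c i v w = ∑ m, ∑ n, (v m * w n) • lab ⟨(a, b), m, n, i⟩ := rfl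

theorem tens_single {f g : S.Obj} (a b c : S.L) (i : Fin (S.N a b c)) (m : Fin (f a))
    (n : Fin (g b)) :
    tens a b c i (Pi.single m 1 : Cov f a) (Pi.single n 1 : Cov g b) = lab ⟨(a, b), m, n, i⟩ := by
  rw [tens_apply, Finset.sum_eq_single m, Finset.sum_eq_single n]
  · simp
  · intro n' _ h; simp [h]
  · simp
  · intro m' _ h; simp [h]
  · simp

/-- The covectors `tens a b c i v w` span. -/
theorem tens_ext {M : Type*} [AddCommMonoid M] [Module k M] {f g : S.Obj} {c : S.L}
    {φ ψ : Cov (tensObj f g) c →ₗ[k] M}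
    (h : ∀ a b i v w, φ (tens a b c i v w) = ψ (tens a b c i v w)) : φ = ψ := by
  refine LinearMap.pi_ext' fun x => LinearMap.ext_ring ?_
  obtain ⟨⟨⟨a, b⟩, m, n, i⟩, rfl⟩ := (idx f g c).symm.surjective x
  have := h a b i (Pi.single m 1) (Pi.single n 1)
  rwa [tens_single] at this

/-- Bilinear maps on covectors agree if they agree on coordinate covectors. -/
theorem cov_ext₂ {M : Type*} [AddCommMonoid M] [Module k M] {f g : S.Obj} {a b : S.L}
    {φ ψ : Cov f a →ₗ[k] Cov g b →ₗ[k] M}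
    (h : ∀ m n, φ (Pi.single m 1) (Pi.single n 1) = ψ (Pi.single m 1) (Pi.single n 1)) : φ = ψ :=
  LinearMap.pi_ext' fun m => LinearMap.ext_ring <|
    LinearMap.pi_ext' fun n => LinearMap.ext_ring <| h m n

theorem tensHom_apply {f f' g g' : S.Obj} (A : f ⟶ f') (B : g ⟶ g') (c : S.L)
    (a b a' b' : S.L) (i : Fin (S.N a b c)) (i' : Fin (S.N a' b' c)) (m : Fin (f' a))
    (n : Fin (g' b)) (m' : Fin (f a')) (n' : Fin (g b')) :
    Obj.mat (tensHom A B) c ((idx f' g' c).symm ⟨(a, b), m, n, i⟩)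
      ((idx f g c).symm ⟨(a', b'), m', n', i'⟩) =
    ∑ x, ∑ y, (Obj.mat A a m x * Obj.mat B b n y) *
      (if (⟨(a', b'), m', n', i'⟩ : TIdx f g c) = ⟨(a, b), x, y, i⟩ then 1 else 0) := by
  simp only [Obj.mat, tensHom, Matrix.submatrix_apply, Equiv.apply_symm_apply]
  by_cases h : (a, b) = (a', b')
  · obtain ⟨rfl, rfl⟩ := Prod.mk.inj h
    rw [Matrix.blockDiagonal'_apply_eq, Finset.sum_eq_single m', Finset.sum_eq_single n']
    · simp [Matrix.kroneckerMap_apply, Matrix.one_apply, eq_comm]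
    · intro y _ hy; simp [Ne.symm hy]
    · simp
    · intro x _ hx; simp [Ne.symm hx]
    · simp
  · rw [Matrix.blockDiagonal'_apply_ne _ _ _ h]
    refine (Finset.sum_eq_zero fun x _ => Finset.sum_eq_zero fun y _ => ?_).symm
    rw [if_neg, mul_zero]
    intro hh
    exact h (congrArg Sigma.fst hh).symm

theorem lab_apply {f g : S.Obj} {c : S.L} (x y : TIdx f g c) :
    lab x ((idx f g c).symm y) = (if y = x then 1 else 0 : k) := by
  simp [lab, Pi.single_apply]

theorem act_tensHom {f f' g g' : S.Obj} (A : f ⟶ f') (B : g ⟶ g') {a b c : S.L}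
    (i : Fin (S.N a b c)) (v : Cov f' a) (w : Cov g' b) :
    act (tensHom A B) c (tens a b c i v w) = tens a b c i (act A a v) (act B b w) := by
  have key : (tens a b c i).compr₂ (act (tensHom A B) c) =
      (tens a b c i).compl₁₂ (act A a) (act B b) := by
    refine cov_ext₂ fun m n => funext fun x => ?_
    obtain ⟨⟨⟨a', b'⟩, m', n', i'⟩, rfl⟩ := (idx f g c).symm.surjective x
    simp only [LinearMap.compr₂_apply, LinearMap.compl₁₂_apply, tens_single, act_single]
    rw [lab, act_single, tensHom_apply, tens_apply]
    simp only [Finset.sum_apply, Pi.smul_apply, lab_apply, smul_eq_mul]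
  exact congrArg (fun φ => φ v w) key

/-- Coordinate covectors of a left-bracketed triple tensor product. -/
theorem tens_tens_left {f g h : S.Obj} {a b c e u : S.L} (i : Fin (S.N a b e))
    (j : Fin (S.N e c u)) (m : Fin (f a)) (n : Fin (g b)) (l : Fin (h c)) :
    tens e c u j (tens a b e i (Pi.single m 1 : Cov f a) (Pi.single n 1 : Cov g b))
      (Pi.single l 1 : Cov h c) =
      Pi.single ((idxLeft f g h u).symm ⟨(a, b, c), (m, n, l), ⟨e, i, j⟩⟩) 1 := by
  rw [tens_single, lab, tens_single]; rfl

/-- Coordinate covectors of a right-bracketed triple tensor product. -/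
theorem tens_tens_right {f g h : S.Obj} {a b c e u : S.L} (i : Fin (S.N a e u))
    (j : Fin (S.N b c e)) (m : Fin (f a)) (n : Fin (g b)) (l : Fin (h c)) :
    tens a e u i (Pi.single m 1 : Cov f a) (tens b c e j (Pi.single n 1 : Cov g b)
      (Pi.single l 1 : Cov h c)) =
      Pi.single ((idxRight f g h u).symm ⟨(a, b, c), (m, n, l), ⟨e, i, j⟩⟩) 1 := by
  rw [tens_single, lab, tens_single]; rfl

theorem act_assoc_single (f g h : S.Obj) {a b c e u : S.L} (i : Fin (S.N a b e))
    (j : Fin (S.N e c u)) (m : Fin (f a)) (n : Fin (g b)) (l : Fin (h c)) :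
    act (assocIso f g h).hom u
      (tens e c u j (tens a b e i (Pi.single m 1 : Cov f a) (Pi.single n 1 : Cov g b))
        (Pi.single l 1 : Cov h c)) =
      ∑ e' : S.L, ∑ i' : Fin (S.N a e' u), ∑ j' : Fin (S.N b c e'), S.F.entry i j i' j' •
        tens a e' u i' (Pi.single m 1 : Cov f a) (tens b c e' j' (Pi.single n 1 : Cov g b)
          (Pi.single l 1 : Cov h c)) := by
  simp only [tens_tens_left, tens_tens_right, act_single]
  funext x
  obtain ⟨⟨⟨a', b', c'⟩, ⟨m', n', l'⟩, ⟨e₀, i₀, j₀⟩⟩, rfl⟩ := (idxRight f g h u).symm.surjective x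
  simp only [Finset.sum_apply, Pi.smul_apply, Pi.single_apply, smul_eq_mul,
    EmbeddingLike.apply_eq_iff_eq]
  simp only [Obj.mat, assocIso, Matrix.submatrix_apply, Equiv.apply_symm_apply]
  by_cases hp : (a, b, c) = (a', b', c')
  · simp only [Prod.mk.injEq] at hp
    obtain ⟨rfl, rfl, rfl⟩ := hp
    rw [Matrix.blockDiagonal'_apply_eq, Matrix.kroneckerMap_apply, Matrix.one_apply]
    by_cases hm : (m, n, l) = (m', n', l')
    · simp only [Prod.mk.injEq] at hm
      obtain ⟨rfl, rfl, rfl⟩ := hm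
      -- Only the summand whose labels are those of the coordinate `x` contributes.
      rw [Finset.sum_eq_single e₀, Finset.sum_eq_single i₀, Finset.sum_eq_single j₀]
      · simp [FusionRuleData.FMatrices.entry]
      · intro y _ hy; simp [Ne.symm hy]
      · simp
      · intro y _ hy; simp [Ne.symm hy]
      · simp
      · intro y _ hy; simp [Ne.symm hy]
      · simp
    · rw [if_neg hm, zero_mul]
      refine (Finset.sum_eq_zero fun x _ => Finset.sum_eq_zero fun y _ =>
        Finset.sum_eq_zero fun z _ => ?_).symm
      rw [if_neg, mul_zero]
      intro hh
      have := (Sigma.mk.inj hh).2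
      exact hm (congrArg Prod.fst (eq_of_heq this)).symm
  · rw [Matrix.blockDiagonal'_apply_ne _ _ _ hp]
    refine (Finset.sum_eq_zero fun x _ => Finset.sum_eq_zero fun y _ =>
      Finset.sum_eq_zero fun z _ => ?_).symm
    rw [if_neg, mul_zero]
    intro hh
    exact hp (congrArg Sigma.fst hh).symm

/-- The action of the associativity isomorphism on covectors is by the matrices `F`. -/
theorem act_assoc (f g h : S.Obj) {a b c e u : S.L} (i : Fin (S.N a b e)) (j : Fin (S.N e c u))
    (v : Cov f a) (w : Cov g b) (z : Cov h c) :
    act (assocIso f g h).hom u (tens e c u j (tens a b e i v w) z) =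
      ∑ e' : S.L, ∑ i' : Fin (S.N a e' u), ∑ j' : Fin (S.N b c e'), S.F.entry i j i' j' •
        tens a e' u i' v (tens b c e' j' w z) := by
  refine LinearMap.congr_fun (f := act (assocIso f g h).hom u ∘ₗ tens e c u j (tens a b e i v w))
    (g := ∑ e' : S.L, ∑ i' : Fin (S.N a e' u), ∑ j' : Fin (S.N b c e'), S.F.entry i j i' j' •
        (tens a e' u i' v ∘ₗ tens b c e' j' w)) ?_ z |>.trans (by simp)
  refine LinearMap.pi_ext' fun l => LinearMap.ext_ring ?_
  have key : (tens a b e i).compr₂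
      (act (assocIso f g h).hom u ∘ₗ (tens e c u j).flip (Pi.single l 1)) =
      ∑ e' : S.L, ∑ i' : Fin (S.N a e' u), ∑ j' : Fin (S.N b c e'), S.F.entry i j i' j' •
        (tens a e' u i').compl₂ ((tens b c e' j').flip (Pi.single l 1)) := by
    refine cov_ext₂ fun m n => ?_
    simpa using act_assoc_single f g h i j m n l
  simpa using congrArg (fun φ => φ v w) key

end FusionSystem

/-! ### The monoidal category `C(L, N, F)` -/

section SumReordering

variable {M : Type*} [AddCommMonoid M]

theorem sum_comm_two {A B : Type*} {D : B → Type*} [Fintype A] [Fintype B] [∀ b, Fintype (D b)]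
    (f : A → ∀ b, D b → M) :
    ∑ x, ∑ b, ∑ d, f x b d = ∑ b, ∑ d, ∑ x, f x b d := by
  rw [Finset.sum_comm]
  exact Finset.sum_congr rfl fun b _ => Finset.sum_comm

theorem sum_comm_three {A B : Type*} {D : B → Type*} {E : B → Type*} [Fintype A] [Fintype B]
    [∀ b, Fintype (D b)] [∀ b, Fintype (E b)] (f : A → ∀ b, D b → E b → M) :
    ∑ x, ∑ b, ∑ d, ∑ e, f x b d e = ∑ b, ∑ d, ∑ e, ∑ x, f x b d e := by
  rw [sum_comm_two]
  exact Finset.sum_congr rfl fun b _ => Finset.sum_congr rfl fun d _ => Finset.sum_comm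

theorem sum_comm_five {X L : Type*} {B D : L → Type*} {E : L → L → Type*} [Fintype X] [Fintype L]
    [∀ g, Fintype (B g)] [∀ h, Fintype (D h)] [∀ g h, Fintype (E g h)]
    (f : X → ∀ h, D h → ∀ g, E g h → B g → M) :
    ∑ x, ∑ h, ∑ n, ∑ g, ∑ o, ∑ m, f x h n g o m = ∑ h, ∑ n, ∑ g, ∑ o, ∑ m, ∑ x, f x h n g o m := by
  rw [sum_comm_two]
  exact Finset.sum_congr rfl fun h _ => Finset.sum_congr rfl fun n _ => sum_comm_three _

/-- The order of summation in one side of the pentagon equation. -/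
theorem sum_reorder_six {L : Type*} {A B D : L → Type*} {E : L → L → Type*} [Fintype L]
    [∀ g, Fintype (A g)] [∀ g, Fintype (B g)] [∀ h, Fintype (D h)] [∀ g h, Fintype (E g h)]
    (f : ∀ g, A g → B g → ∀ h, D h → E g h → M) :
    ∑ g, ∑ l, ∑ m, ∑ h, ∑ n, ∑ o, f g l m h n o =
      ∑ h, ∑ n, ∑ g, ∑ o, ∑ m, ∑ l, f g l m h n o := by
  refine Eq.trans (Finset.sum_congr rfl fun g _ => ?_) (sum_comm_two _)
  simp only [sum_comm_three (A := B _)]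
  exact sum_comm_three _ |>.trans <| Finset.sum_congr rfl fun h _ => Finset.sum_congr rfl fun n _ =>
    Finset.sum_congr rfl fun o _ => Finset.sum_comm

/-- The order of summation in the other side of the pentagon equation. -/
theorem sum_reorder_nine {L : Type*} {A B D Y : L → Type*} {E Z : L → L → Type*} [Fintype L]
    [∀ q, Fintype (A q)] [∀ q, Fintype (Y q)] [∀ g, Fintype (B g)] [∀ h, Fintype (D h)]
    [∀ g h, Fintype (E g h)] [∀ q h, Fintype (Z q h)]
    (f : ∀ q, A q → Y q → ∀ h, D h → Z q h → ∀ g, E g h → B g → M) :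
    ∑ q, ∑ p, ∑ r, ∑ h, ∑ n, ∑ v, ∑ g, ∑ o, ∑ m, f q p r h n v g o m =
      ∑ h, ∑ n, ∑ g, ∑ o, ∑ m, ∑ q, ∑ p, ∑ r, ∑ v, f q p r h n v g o m := by
  refine (Finset.sum_congr rfl fun q _ => ?_).trans (sum_comm_five _)
  refine (Finset.sum_congr rfl fun p _ => ?_).trans (sum_comm_five _)
  refine (Finset.sum_congr rfl fun r _ => ?_).trans (sum_comm_five _)
  exact Finset.sum_congr rfl fun h _ => Finset.sum_congr rfl fun n _ => sum_comm_three _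

end SumReordering

namespace FusionSystem

variable {k : Type t} [Field k] {S : FusionSystem.{t, w} k}

theorem act_eqToHom {f g : S.Obj} (h : f = g) (a : S.L) (v : Cov g a) (x : Fin (f a)) :
    act (eqToHom h) a v x = v (Fin.cast (by rw [h]) x) := by
  subst h
  simp

theorem orderIsoFinOfCardEq_symm_lt {α : Type*} [Fintype α] (_ : LinearOrder α) {n : ℕ}
    (h : Fintype.card α = n) {x y : α} (hxy : x < y) :
    (Fintype.orderIsoFinOfCardEq α h).toEquiv.symm x <
      (Fintype.orderIsoFinOfCardEq α h).toEquiv.symm y :=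
  (Fintype.orderIsoFinOfCardEq α h).symm.strictMono hxy

/-- The enumeration of basis labels is by definition increasing for the lexicographic order. -/
theorem idx_symm_lt {f g : S.Obj} {c : S.L} {x y : TIdx f g c} (h : x.key < y.key) :
    (idx f g c).symm x < (idx f g c).symm y :=
  orderIsoFinOfCardEq_symm_lt (TIdx.linearOrder f g c) (card_tIdx f g c) h

theorem val_eq_of_strictMono {m n : ℕ} (h : m = n) (φ : Fin m → Fin n) (hφ : StrictMono φ)
    (x : Fin m) : (φ x : ℕ) = x := by
  subst h
  have hid : φ = id := StrictMono.range_inj hφ strictMono_id |>.1 <| by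
    rw [Set.range_id, Set.range_eq_univ]
    exact Finite.surjective_of_injective hφ.injective
  rw [hid]; rfl

/-- The coordinate covector of the neutral object. -/
def unitCov : Cov (unitObj : S.Obj) S.R.one := fun _ => 1

theorem unitObj_one : (unitObj : S.Obj) S.R.one = 1 := by simp [unitObj, delta]

theorem unitObj_ne {a : S.L} (h : S.R.one ≠ a) : (unitObj : S.Obj) a = 0 := by
  simp [unitObj, delta, h]

theorem unitCov_eq_single (x : Fin ((unitObj : S.Obj) S.R.one)) :
    (unitCov : Cov (unitObj : S.Obj) S.R.one) = Pi.single x 1 := by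
  funext y
  have : x = y := Fin.ext (by
    have h₁ := x.2.trans_eq unitObj_one
    have h₂ := y.2.trans_eq unitObj_one
    omega)
  subst this
  simp [unitCov]

theorem act_leftUnitor (f : S.Obj) {a : S.L} (i : Fin (S.N S.R.one a a)) (v : Cov f a) :
    act (eqToIso (unit_tensObj f)).hom a v = tens S.R.one a a i unitCov v := by
  refine LinearMap.congr_fun (f := act (eqToIso (unit_tensObj f)).hom a)
    (g := tens S.R.one a a i unitCov) (LinearMap.pi_ext' fun m => LinearMap.ext_ring ?_) v
  let o : Fin ((unitObj : S.Obj) S.R.one) := ⟨0, by rw [unitObj_one]; exact one_pos⟩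
  have hval := val_eq_of_strictMono (congrArg (fun f : S.Obj => f a) (unit_tensObj f)).symm
    (fun m => (idx unitObj f a).symm ⟨(S.R.one, a), o, m, i⟩)
    (fun m n h => idx_symm_lt (by simpa [TIdx.key, Prod.Lex.toLex_lt_toLex] using h)) m
  simp only [LinearMap.comp_apply, LinearMap.single_apply, unitCov_eq_single o]
  rw [tens_single]
  funext x
  rw [eqToIso.hom, act_eqToHom]
  simp only [lab, Pi.single_apply, Fin.ext_iff, Fin.val_cast]
  rw [hval]

theorem act_rightUnitor (f : S.Obj) {a : S.L} (i : Fin (S.N a S.R.one a)) (v : Cov f a) :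
    act (eqToIso (tensObj_unit f)).hom a v = tens a S.R.one a i v unitCov := by
  refine LinearMap.congr_fun (f := act (eqToIso (tensObj_unit f)).hom a)
    (g := (tens a S.R.one a i).flip unitCov)
    (LinearMap.pi_ext' fun m => LinearMap.ext_ring ?_) v
  let o : Fin ((unitObj : S.Obj) S.R.one) := ⟨0, by rw [unitObj_one]; exact one_pos⟩
  have hval := val_eq_of_strictMono (congrArg (fun f : S.Obj => f a) (tensObj_unit f)).symm
    (fun m => (idx f unitObj a).symm ⟨(a, S.R.one), m, o, i⟩)
    (fun m n h => idx_symm_lt (by simpa [TIdx.key, Prod.Lex.toLex_lt_toLex] using h)) m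
  simp only [LinearMap.comp_apply, LinearMap.single_apply, unitCov_eq_single o,
    LinearMap.flip_apply]
  rw [tens_single]
  funext x
  rw [eqToIso.hom, act_eqToHom]
  simp only [lab, Pi.single_apply, Fin.ext_iff, Fin.val_cast]
  rw [hval]

theorem N_one_left_pos (a : S.L) : 0 < S.N S.R.one a a := by
  simp [N, S.isFusionSystem.N_one_left]

theorem N_one_right_pos (a : S.L) : 0 < S.N a S.R.one a := by
  simp [N, S.isFusionSystem.N_one_right]

theorem tensHom_id (f g : S.Obj) : tensHom (𝟙 f) (𝟙 g) = 𝟙 (tensObj f g) :=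
  hom_ext fun c => tens_ext fun a b i v w => by
    rw [act_tensHom]; simp

theorem tensHom_comp {f f' f'' g g' g'' : S.Obj} (A : f ⟶ f') (B : g ⟶ g') (A' : f' ⟶ f'')
    (B' : g' ⟶ g'') : tensHom A B ≫ tensHom A' B' = tensHom (A ≫ A') (B ≫ B') :=
  hom_ext fun c => tens_ext fun a b i v w => by
    simp only [act_comp_apply, act_tensHom]

/-- Linear maps on covectors of `(f ⊗ g) ⊗ h` agree if they agree on iterated tensors. -/
theorem tens_ext₃ {M : Type*} [AddCommMonoid M] [Module k M] {f g h : S.Obj} {u : S.L}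
    {φ ψ : Cov (tensObj (tensObj f g) h) u →ₗ[k] M}
    (H : ∀ a b c e i j v w z, φ (tens e c u j (tens a b e i v w) z) =
      ψ (tens e c u j (tens a b e i v w) z)) : φ = ψ := by
  refine tens_ext fun e c j x z => ?_
  refine LinearMap.congr_fun (f := φ ∘ₗ (tens e c u j).flip z) (g := ψ ∘ₗ (tens e c u j).flip z)
    (tens_ext fun a b i v w => ?_) x
  exact H a b c e i j v w z

theorem tens_ext₄ {M : Type*} [AddCommMonoid M] [Module k M] {f g h l : S.Obj} {u : S.L}
    {φ ψ : Cov (tensObj (tensObj (tensObj f g) h) l) u →ₗ[k] M}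
    (H : ∀ a b c d e r i j n v w z y,
      φ (tens r d u n (tens e c r j (tens a b e i v w) z) y) =
      ψ (tens r d u n (tens e c r j (tens a b e i v w) z) y)) : φ = ψ := by
  refine tens_ext fun r d n x y => ?_
  refine LinearMap.congr_fun (f := φ ∘ₗ (tens r d u n).flip y) (g := ψ ∘ₗ (tens r d u n).flip y)
    (tens_ext₃ fun a b c e i j v w z => ?_) x
  exact H a b c d e r i j n v w z y

theorem assoc_naturality {f f' g g' h h' : S.Obj} (A : f ⟶ f') (B : g ⟶ g') (D : h ⟶ h') :
    (assocIso f g h).hom ≫ tensHom (tensHom A B) D =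
      tensHom A (tensHom B D) ≫ (assocIso f' g' h').hom :=
  hom_ext fun u => tens_ext₃ fun a b c e i j v w z => by
    simp only [act_comp_apply, act_tensHom, act_assoc, map_sum, map_smul]

theorem leftUnitor_naturality {f g : S.Obj} (A : f ⟶ g) :
    tensHom (𝟙 unitObj) A ≫ (eqToIso (unit_tensObj g)).hom =
      (eqToIso (unit_tensObj f)).hom ≫ A :=
  hom_ext fun a => LinearMap.ext fun v => by
    have i : Fin (S.N S.R.one a a) := ⟨0, N_one_left_pos a⟩
    rw [act_comp_apply, act_comp_apply, act_leftUnitor g i, act_leftUnitor f i, act_tensHom]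
    simp

theorem rightUnitor_naturality {f g : S.Obj} (A : f ⟶ g) :
    tensHom A (𝟙 unitObj) ≫ (eqToIso (tensObj_unit g)).hom =
      (eqToIso (tensObj_unit f)).hom ≫ A :=
  hom_ext fun a => LinearMap.ext fun v => by
    have i : Fin (S.N a S.R.one a) := ⟨0, N_one_right_pos a⟩
    rw [act_comp_apply, act_comp_apply, act_rightUnitor g i, act_rightUnitor f i, act_tensHom]
    simp

theorem triangle_assocIso (f g : S.Obj) :
    (assocIso f unitObj g).hom ≫ tensHom (eqToIso (tensObj_unit f)).hom (𝟙 g) =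
      tensHom (𝟙 f) (eqToIso (unit_tensObj g)).hom :=
  hom_ext fun u => tens_ext fun a b j v w => by
    have i : Fin (S.N a S.R.one a) := ⟨0, N_one_right_pos a⟩
    have i' : Fin (S.N S.R.one b b) := ⟨0, N_one_left_pos b⟩
    rw [act_comp_apply, act_tensHom, act_tensHom, act_rightUnitor f i, act_leftUnitor g i']
    simp only [act_id, LinearMap.id_apply]
    rw [act_assoc, Finset.sum_eq_single b]
    · have hsub : Subsingleton (Fin (S.N S.R.one b b)) := by
        simp only [N, S.isFusionSystem.N_one_left, if_true]; infer_instance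
      simp only [Fintype.sum_subsingleton _ i', S.isFusionSystem.triangle]
      rw [Finset.sum_eq_single j] <;> simp +contextual [eq_comm]
    · intro e' _ he
      refine Finset.sum_eq_zero fun x _ => Finset.sum_eq_zero fun y _ => ?_
      have hy := y.2
      simp [N, S.isFusionSystem.N_one_left, Ne.symm he] at hy
    · simp

theorem pentagon_assocIso (f g h l : S.Obj) :
    tensHom (𝟙 f) (assocIso g h l).hom ≫ (assocIso f (tensObj g h) l).hom ≫
      tensHom (assocIso f g h).hom (𝟙 l) =
      (assocIso f g (tensObj h l)).hom ≫ (assocIso (tensObj f g) h l).hom :=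
  hom_ext fun u => tens_ext₄ fun a b c d e f' i j k' v w z y => by
    simp only [act_comp_apply, act_tensHom, act_assoc, map_sum, map_smul, act_id,
      LinearMap.id_apply, LinearMap.sum_apply, LinearMap.smul_apply, Finset.smul_sum, smul_smul]
    refine (sum_reorder_nine _).trans (Eq.trans ?_ (sum_reorder_six _).symm)
    simp only [← Finset.sum_smul, mul_assoc]
    simp only [S.isFusionSystem.pentagon, mul_assoc]

/-- The tensor product, associativity and unit isomorphisms of `C(L, N, F)` satisfy the axioms of a
monoidal category. -/
@[reducible] def monoidalCategory (S : FusionSystem.{t, w} k) : MonoidalCategory S.Obj :=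
  letI := S.monoidalStruct
  { S.monoidalStruct with
    tensorHom_def := fun A B => by
      change tensHom A B = tensHom A (𝟙 _) ≫ tensHom (𝟙 _) B
      rw [tensHom_comp, Category.comp_id, Category.id_comp]
    id_tensorHom_id := tensHom_id
    tensorHom_comp_tensorHom := tensHom_comp
    whiskerLeft_id := tensHom_id
    id_whiskerRight := tensHom_id
    associator_naturality := fun {f g h f' g' h'} A B D => by
      change tensHom (tensHom A B) D ≫ (assocIso f' g' h').inv =
        (assocIso f g h).inv ≫ tensHom A (tensHom B D)
      rw [Iso.comp_inv_eq, Category.assoc, ← assoc_naturality, Iso.inv_hom_id_assoc]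
    leftUnitor_naturality := leftUnitor_naturality
    rightUnitor_naturality := rightUnitor_naturality
    pentagon := fun f g h l => by
      change tensHom (assocIso f g h).inv (𝟙 l) ≫ (assocIso f (tensObj g h) l).inv ≫
        tensHom (𝟙 f) (assocIso g h l).inv =
          (assocIso (tensObj f g) h l).inv ≫ (assocIso f g (tensObj h l)).inv
      have h₁ : ∀ {a b : S.Obj} (c : S.Obj) (e : a ≅ b),
          tensHom e.inv (𝟙 c) ≫ tensHom e.hom (𝟙 c) = 𝟙 _ := fun c e => by
        rw [tensHom_comp, e.inv_hom_id, Category.id_comp, tensHom_id]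
      have h₂ : ∀ {a b : S.Obj} (c : S.Obj) (e : a ≅ b),
          tensHom (𝟙 c) e.inv ≫ tensHom (𝟙 c) e.hom = 𝟙 _ := fun c e => by
        rw [tensHom_comp, e.inv_hom_id, Category.id_comp, tensHom_id]
      rw [← Iso.trans_inv, ← Iso.comp_hom_eq_id, Iso.trans_hom, ← pentagon_assocIso]
      simp only [Category.assoc]
      rw [reassoc_of% (h₂ f (assocIso g h l)), Iso.inv_hom_id_assoc, h₁]
    triangle := fun f g => by
      change (assocIso f unitObj g).inv ≫ tensHom (𝟙 f) (eqToIso (unit_tensObj g)).hom =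
        tensHom (eqToIso (tensObj_unit f)).hom (𝟙 g)
      rw [Iso.inv_comp_eq, triangle_assocIso] }

end FusionSystem

/-! ### Simple families and semisimplicity -/

section SimpleFamilies

variable (k : Type t) [Field k] {C : Type u} [Category.{v} C] [Preadditive C] [Linear k C]
  {L : Type w}

/-- Pairwise non-isomorphic objects with endomorphism space `k`, without non-zero morphisms between
different ones, such that the identity of every object of `C` is a finite sum of morphisms which
factor through them. -/
structure IsSimpleFamily (X : L → C) : Prop where
  end_eq_smul : ∀ a (f : X a ⟶ X a), ∃ r : k, f = r • 𝟙 (X a)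
  id_ne_zero : ∀ a, 𝟙 (X a) ≠ 0
  hom_eq_zero : ∀ {a b}, a ≠ b → ∀ f : X a ⟶ X b, f = 0
  decomp : ∀ Y : C, ∃ (n : ℕ) (l : Fin n → L) (ι : ∀ i, X (l i) ⟶ Y) (π : ∀ i, Y ⟶ X (l i)),
    ∑ i, π i ≫ ι i = 𝟙 Y

variable {k}

namespace IsSimpleFamily

variable {X : L → C} (hX : IsSimpleFamily k X)

include hX

/-- Morphisms are determined by their composites with morphisms to simple objects. -/
theorem hom_ext {Y Z : C} {h h' : Y ⟶ Z} (H : ∀ a (g : Z ⟶ X a), h ≫ g = h' ≫ g) : h = h' := by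
  obtain ⟨n, l, ι, π, e⟩ := hX.decomp Z
  rw [← Category.comp_id h, ← Category.comp_id h', ← e]
  simp only [Preadditive.comp_sum, ← Category.assoc, H]

theorem comp_eq {Y Z : C} (θ : ∀ a, (Z ⟶ X a) →ₗ[k] (Y ⟶ X a)) {a b : L} (p : Z ⟶ X a)
    (s : X a ⟶ X b) : θ b (p ≫ s) = θ a p ≫ s := by
  by_cases h : a = b
  · subst h
    obtain ⟨r, rfl⟩ := hX.end_eq_smul a s
    simp
  · simp [hX.hom_eq_zero h s]

theorem exists_hom {Y Z : C} (θ : ∀ a, (Z ⟶ X a) →ₗ[k] (Y ⟶ X a)) :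
    ∃ h : Y ⟶ Z, ∀ a (g : Z ⟶ X a), h ≫ g = θ a g := by
  obtain ⟨n, l, ι, π, e⟩ := hX.decomp Z
  refine ⟨∑ i, θ (l i) (π i) ≫ ι i, fun a g => ?_⟩
  conv_rhs => rw [← Category.id_comp g, ← e, Preadditive.sum_comp, map_sum]
  simp only [Preadditive.sum_comp, Category.assoc, hX.comp_eq θ]

/-- The morphism which induces prescribed linear maps between the spaces of morphisms to simple
objects: by semisimplicity, every family of linear maps is induced by a unique morphism. -/
def homOf {Y Z : C} (θ : ∀ a, (Z ⟶ X a) →ₗ[k] (Y ⟶ X a)) : Y ⟶ Z := (hX.exists_hom θ).choose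

theorem homOf_comp {Y Z : C} (θ : ∀ a, (Z ⟶ X a) →ₗ[k] (Y ⟶ X a)) {a : L} (g : Z ⟶ X a) :
    hX.homOf θ ≫ g = θ a g := (hX.exists_hom θ).choose_spec a g

theorem isIso_of_bijective {Y Z : C} (h : Y ⟶ Z)
    (H : ∀ a, Function.Bijective fun g : Z ⟶ X a => h ≫ g) : IsIso h := by
  let θ : ∀ a, (Y ⟶ X a) →ₗ[k] (Z ⟶ X a) := fun a =>
    (LinearEquiv.ofBijective (Linear.leftComp k (X a) h) (H a)).symm.toLinearMap
  have hθ : ∀ a (g : Y ⟶ X a), h ≫ θ a g = g := fun a g =>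
    LinearEquiv.apply_symm_apply (LinearEquiv.ofBijective (Linear.leftComp k (X a) h) (H a)) g
  refine ⟨hX.homOf θ, hX.hom_ext fun a g => ?_, hX.hom_ext fun a g => (H a).1 ?_⟩
  · simp [Category.assoc, hX.homOf_comp, hθ]
  · simp [Category.assoc, hX.homOf_comp, hθ]

theorem finrank_end (a : L) : Module.finrank k (X a ⟶ X a) = 1 :=
  finrank_eq_one (𝟙 (X a)) (hX.id_ne_zero a) fun f =>
    let ⟨r, hr⟩ := hX.end_eq_smul a f; ⟨r, hr.symm⟩

theorem finrank_hom [DecidableEq L] (a b : L) :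
    Module.finrank k (X a ⟶ X b) = if a = b then 1 else 0 := by
  split_ifs with h
  · subst h; exact hX.finrank_end a
  · have : Subsingleton (X a ⟶ X b) :=
      ⟨fun f g => (hX.hom_eq_zero h f).trans (hX.hom_eq_zero h g).symm⟩
    exact Module.finrank_zero_of_subsingleton

theorem eq_of_ne_zero {a b : L} {f : X a ⟶ X b} (hf : f ≠ 0) : a = b := by
  by_contra h
  exact hf (hX.hom_eq_zero h f)

/-- A non-zero object with endomorphism space `k` is one of the simple objects. -/
theorem exists_iso_of_end {Y : C} (h₀ : 𝟙 Y ≠ 0) (h₁ : ∀ f : Y ⟶ Y, ∃ r : k, f = r • 𝟙 Y) :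
    ∃ a, Nonempty (Y ≅ X a) := by
  obtain ⟨n, l, ι, π, e⟩ := hX.decomp Y
  obtain ⟨i, -, hi⟩ := Finset.exists_ne_zero_of_sum_ne_zero (e.trans_ne h₀)
  obtain ⟨c, hc⟩ := h₁ (π i ≫ ι i)
  obtain ⟨r, hr⟩ := hX.end_eq_smul _ (ι i ≫ π i)
  have hc₀ : c ≠ 0 := by rintro rfl; exact hi (by simp [hc])
  have hπ : π i ≠ 0 := fun h => hi (by simp [h])
  have : c • π i = r • π i := by
    have : (π i ≫ ι i) ≫ π i = π i ≫ (ι i ≫ π i) := Category.assoc _ _ _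
    rw [hc, hr] at this
    simpa using this
  have hrc : c = r := smul_left_injective k hπ this
  subst hrc
  exact ⟨l i, ⟨{ hom := π i, inv := c⁻¹ • ι i,
                 hom_inv_id := by simp [hc, smul_smul, hc₀],
                 inv_hom_id := by simp [hr, smul_smul, hc₀] }⟩⟩

/-- By semisimplicity, an object that receives a non-zero morphism from a simple object has a
non-zero morphism to it. -/
theorem exists_ne_zero_of_ne_zero {a : L} {Y : C} {f : X a ⟶ Y} (hf : f ≠ 0) :
    ∃ g : Y ⟶ X a, g ≠ 0 := by
  obtain ⟨n, l, ι, π, e⟩ := hX.decomp Y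
  rw [← Category.comp_id f, ← e, Preadditive.comp_sum] at hf
  obtain ⟨i, -, hi⟩ := Finset.exists_ne_zero_of_sum_ne_zero hf
  have h₁ : f ≫ π i ≠ 0 := fun h => hi (by rw [← Category.assoc, h, Limits.zero_comp])
  obtain rfl := hX.eq_of_ne_zero h₁
  exact ⟨π i, fun h => h₁ (by rw [h, Limits.comp_zero])⟩

/-- Bases of the spaces of morphisms from `Y` to the simple objects exhibit `Y` as a direct sum. -/
theorem exists_dual_basis [Fintype L] {Y : C} {I : L → Type*} [∀ a, Fintype (I a)]
    [∀ a, DecidableEq (I a)] (y : ∀ a, Module.Basis (I a) k (Y ⟶ X a)) :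
    ∃ ι : ∀ a, I a → (X a ⟶ Y),
      (∀ a m m', ι a m ≫ y a m' = if m = m' then 𝟙 (X a) else 0) ∧
      ∑ a, ∑ m, y a m ≫ ι a m = 𝟙 Y := by
  classical
  let θ : ∀ a (_ : I a) b, (Y ⟶ X b) →ₗ[k] (X a ⟶ X b) := fun a m b =>
    (y b).constr k fun m' => if h : a = b then (if h ▸ m = m' then eqToHom (by rw [h]) else 0) else 0
  have H : ∀ a m m', hX.homOf (θ a m) ≫ y a m' = if m = m' then 𝟙 (X a) else 0 := fun a m m' => by
    rw [hX.homOf_comp, Module.Basis.constr_basis, dif_pos rfl]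
    rfl
  refine ⟨fun a m => hX.homOf (θ a m), H, hX.hom_ext fun b g => ?_⟩
  rw [Category.id_comp]
  refine LinearMap.congr_fun (f := Linear.leftComp k (X b) (∑ a, ∑ m, y a m ≫ hX.homOf (θ a m)))
    (g := LinearMap.id) ((y b).ext fun m' => ?_) g
  simp only [Linear.leftComp_apply, Preadditive.sum_comp, Category.assoc, LinearMap.id_apply]
  rw [Finset.sum_eq_single b, Finset.sum_eq_single m']
  · rw [H, if_pos rfl, Category.comp_id]
  · intro m _ hm; rw [H, if_neg hm, Limits.comp_zero]
  · simp
  · intro a _ ha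
    exact Finset.sum_eq_zero fun m _ => by rw [hX.hom_eq_zero ha (_ ≫ y b m'), Limits.comp_zero]
  · simp

/-- Let `G` be an additive functor. Bases of the spaces of morphisms `Y ⟶ X a` and `G (X a) ⟶ W`
give a basis of the space of morphisms `G Y ⟶ W`. -/
theorem exists_basis_comp {D : Type*} [Category D] [Preadditive D] [Linear k D] (G : C ⥤ D)
    [G.Additive] [Fintype L] {Y : C} {W : D} {I J : L → Type*} [∀ a, Fintype (I a)]
    [∀ a, Fintype (J a)] (y : ∀ a, Module.Basis (I a) k (Y ⟶ X a))
    (β : ∀ a, Module.Basis (J a) k (G.obj (X a) ⟶ W)) :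
    ∃ B : Module.Basis (Σ a, I a × J a) k (G.obj Y ⟶ W),
      ∀ a m n, B ⟨a, m, n⟩ = G.map (y a m) ≫ β a n := by
  classical
  obtain ⟨ι, h₁, h₂⟩ := hX.exists_dual_basis y
  have h₃ : ∑ a, ∑ m, G.map (y a m) ≫ G.map (ι a m) = 𝟙 (G.obj Y) := by
    rw [← G.map_id, ← h₂]; simp only [Functor.map_sum, Functor.map_comp]
  have li : LinearIndependent k
      (fun x : Σ a, I a × J a => G.map (y x.1 x.2.1) ≫ β x.1 x.2.2) := by
    refine Fintype.linearIndependent_iff.2 fun c hc => ?_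
    rintro ⟨a, m, n⟩
    -- Composing with the dual basis isolates the coefficients that belong to `y a m`.
    have h := congrArg (fun g => G.map (ι a m) ≫ g) hc
    simp only [Limits.comp_zero, Preadditive.comp_sum, Linear.comp_smul, Fintype.sum_sigma,
      Fintype.sum_prod_type, ← Category.assoc, ← Functor.map_comp] at h
    rw [Finset.sum_eq_single a, Finset.sum_eq_single m] at h
    · simp only [h₁, if_true, G.map_id, Category.id_comp] at h
      exact Fintype.linearIndependent_iff.1 (β a).linearIndependent _ h n
    · intro m' _ hm
      simp [h₁, Ne.symm hm]
    · simp
    · intro b _ hb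
      refine Finset.sum_eq_zero fun m' _ => ?_
      simp [hX.hom_eq_zero (Ne.symm hb) (ι a m ≫ y b m')]
    · simp
  refine ⟨Module.Basis.mk li ?_, fun a m n => Module.Basis.mk_apply _ _ _⟩
  rintro g -
  rw [← Category.id_comp g, ← h₃]
  simp only [Preadditive.sum_comp, Category.assoc]
  refine Submodule.sum_mem _ fun a _ => Submodule.sum_mem _ fun m _ => ?_
  rw [← (β a).sum_repr (G.map (ι a m) ≫ g), Preadditive.comp_sum]
  refine Submodule.sum_mem _ fun n _ => ?_
  rw [Linear.comp_smul]
  exact Submodule.smul_mem _ _ (Submodule.subset_span ⟨⟨a, m, n⟩, rfl⟩)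

end IsSimpleFamily

end SimpleFamilies

/-! ### `C(L, N, F)` is abelian, semisimple and skeletal -/

namespace IsSimpleFamily

variable {k : Type t} [Field k] {C : Type u} [Category.{v} C] [Preadditive C] [Linear k C]
  {L : Type w} {X : L → C} (hX : IsSimpleFamily k X)

include hX

/-- By semisimplicity, a non-zero morphism to a simple object has a section. -/
theorem exists_section {Y : C} {a : L} {h : Y ⟶ X a} (hh : h ≠ 0) :
    ∃ s : X a ⟶ Y, s ≫ h = 𝟙 (X a) := by
  obtain ⟨n, l, ι, π, e⟩ := hX.decomp Y
  have : ∑ i, π i ≫ ι i ≫ h ≠ 0 := by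
    simpa only [← Category.assoc, ← Preadditive.sum_comp, e, Category.id_comp] using hh
  obtain ⟨i, -, hi⟩ := Finset.exists_ne_zero_of_sum_ne_zero this
  have h₁ : ι i ≫ h ≠ 0 := fun h₀ => hi (by rw [h₀, Limits.comp_zero])
  obtain rfl := hX.eq_of_ne_zero h₁
  obtain ⟨r, hr⟩ := hX.end_eq_smul _ (ι i ≫ h)
  have hr₀ : r ≠ 0 := by rintro rfl; exact h₁ (by simp [hr])
  exact ⟨r⁻¹ • ι i, by simp [hr, smul_smul, hr₀]⟩

theorem simple (a : L) : Simple (X a) where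
  mono_isIso_iff_nonzero := by
    intro Y h _
    constructor
    · rintro _ rfl
      have : (𝟙 (X a)) = 0 := by rw [← IsIso.inv_hom_id (0 : Y ⟶ X a), Limits.comp_zero]
      exact hX.id_ne_zero a this
    · intro hh
      obtain ⟨s, hs⟩ := hX.exists_section hh
      have : IsSplitEpi h := IsSplitEpi.mk' ⟨s, hs⟩
      exact isIso_of_mono_of_isSplitEpi h

theorem exists_iso_of_simple [Limits.HasKernels C] (Y : C) [Simple Y] :
    ∃ a, Nonempty (Y ≅ X a) := by
  obtain ⟨n, l, ι, π, e⟩ := hX.decomp Y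
  obtain ⟨i, -, hi⟩ := Finset.exists_ne_zero_of_sum_ne_zero (e.trans_ne (id_nonzero Y))
  have h₁ : π i ≠ 0 := fun h₀ => hi (by rw [h₀, Limits.zero_comp])
  have := hX.simple (l i)
  have := isIso_of_hom_simple h₁
  exact ⟨l i, ⟨asIso (π i)⟩⟩

theorem bijective_smul_id [Limits.HasKernels C] (Y : C) [Simple Y] :
    Function.Bijective (fun r : k => r • 𝟙 Y) := by
  obtain ⟨a, ⟨e⟩⟩ := hX.exists_iso_of_simple Y
  refine ⟨smul_left_injective k (id_nonzero Y), fun f => ?_⟩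
  obtain ⟨r, hr⟩ := hX.end_eq_smul a (e.inv ≫ f ≫ e.hom)
  refine ⟨r, ?_⟩
  have := congrArg (fun g => e.hom ≫ g ≫ e.inv) hr
  simpa using this.symm

end IsSimpleFamily

namespace FusionSystem

variable {k : Type t} [Field k] {S : FusionSystem.{t, w} k}

/-- The inclusion of the `m`-th copy of `δ_a` into `f`. -/
def incl (f : S.Obj) (p : Σ a : S.L, Fin (f a)) : delta p.1 ⟶ f :=
  fun b => Matrix.of fun y _ => if (⟨b, y⟩ : Σ a : S.L, Fin (f a)) = p then 1 else 0

/-- The projection from `f` to the `m`-th copy of `δ_a`. -/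
def proj (f : S.Obj) (p : Σ a : S.L, Fin (f a)) : f ⟶ delta p.1 :=
  fun b => Matrix.of fun _ y => if (⟨b, y⟩ : Σ a : S.L, Fin (f a)) = p then 1 else 0

theorem delta_self (a : S.L) : (delta a : S.Obj) a = 1 := by simp [delta]

theorem eq_of_fin_delta {a b : S.L} (x : Fin ((delta a : S.Obj) b)) : a = b := by
  by_contra h
  exact absurd (x.2.trans_eq (show (delta a : S.Obj) b = 0 by simp [delta, h])) (Nat.not_lt_zero _)

instance (a b : S.L) : Subsingleton (Fin ((delta a : S.Obj) b)) := by
  refine ⟨fun x y => Fin.ext ?_⟩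
  obtain rfl := eq_of_fin_delta x
  have h₁ := x.2.trans_eq (delta_self a)
  have h₂ := y.2.trans_eq (delta_self a)
  omega

instance (a : S.L) : Nonempty (Fin ((delta a : S.Obj) a)) := ⟨⟨0, by rw [delta_self]; exact one_pos⟩⟩

theorem incl_proj_self (f : S.Obj) (p : Σ a : S.L, Fin (f a)) :
    incl f p ≫ proj f p = 𝟙 (delta p.1) := by
  obtain ⟨a, m⟩ := p
  refine funext fun b => Matrix.ext fun x y => ?_
  obtain rfl := eq_of_fin_delta x
  obtain rfl := Subsingleton.elim x y
  change (Matrix.of _ * Matrix.of _ : Matrix _ _ k) x x = (1 : Matrix _ _ k) x x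
  rw [Matrix.mul_apply, Finset.sum_eq_single m]
  · simp
  · intro y _ hy; simp [hy]
  · simp

theorem incl_proj_ne (f : S.Obj) {p q : Σ a : S.L, Fin (f a)} (h : p ≠ q) :
    incl f p ≫ proj f q = 0 := by
  refine funext fun b => Matrix.ext fun x y => ?_
  change (Matrix.of _ * Matrix.of _ : Matrix _ _ k) x y = 0
  rw [Matrix.mul_apply]
  refine Finset.sum_eq_zero fun z _ => ?_
  by_cases hz : (⟨b, z⟩ : Σ a : S.L, Fin (f a)) = p
  · simp [hz, h]
  · simp [hz]

theorem sum_apply {f g : S.Obj} {ι : Type*} (s : Finset ι) (A : ι → (f ⟶ g)) (b : S.L)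
    (x : Fin (g b)) (y : Fin (f b)) :
    Obj.mat (∑ i ∈ s, A i) b x y = ∑ i ∈ s, Obj.mat (A i) b x y := by
  classical
  induction s using Finset.induction_on with
  | empty => rfl
  | insert i s hi ih => rw [Finset.sum_insert hi, Finset.sum_insert hi, ← ih]; rfl

theorem sum_proj_incl (f : S.Obj) : ∑ p, proj f p ≫ incl f p = 𝟙 f := by
  refine funext fun b => Matrix.ext fun x y => ?_
  change Obj.mat (∑ p, proj f p ≫ incl f p) b x y = (1 : Matrix _ _ k) x y
  rw [sum_apply, Finset.sum_eq_single ⟨b, x⟩]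
  · change (Matrix.of _ * Matrix.of _ : Matrix _ _ k) x y = (1 : Matrix _ _ k) x y
    rw [Matrix.mul_apply, Fintype.sum_subsingleton _ (Classical.arbitrary _)]
    simp [Matrix.one_apply, eq_comm]
  · intro p _ hp
    change (Matrix.of _ * Matrix.of _ : Matrix _ _ k) x y = 0
    rw [Matrix.mul_apply]
    exact Finset.sum_eq_zero fun z _ => by simp [Ne.symm hp]
  · simp

theorem isSimpleFamily_delta : IsSimpleFamily k (delta : S.L → S.Obj) where
  end_eq_smul a f := by
    let o := Classical.arbitrary (Fin ((delta a : S.Obj) a))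
    refine ⟨Obj.mat f a o o, funext fun b => Matrix.ext fun x y => ?_⟩
    obtain rfl := eq_of_fin_delta x
    obtain rfl := Subsingleton.elim x y
    obtain rfl := Subsingleton.elim o x
    change f a o o = (Obj.mat f a o o • (1 : Matrix _ _ k)) o o
    simp [Obj.mat]
  id_ne_zero a h := by
    let o := Classical.arbitrary (Fin ((delta a : S.Obj) a))
    have : (1 : Matrix (Fin ((delta a : S.Obj) a)) (Fin ((delta a : S.Obj) a)) k) o o = 0 :=
      congrArg (fun A : delta a ⟶ delta a => A a o o) h
    simp at this
  hom_eq_zero h f := by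
    refine funext fun c => Matrix.ext fun x y => ?_
    exact absurd ((eq_of_fin_delta y).trans (eq_of_fin_delta x).symm) h
  decomp f := by
    let e := Fintype.equivFin (Σ a : S.L, Fin (f a))
    refine ⟨_, fun i => (e.symm i).1, fun i => incl f (e.symm i), fun i => proj f (e.symm i), ?_⟩
    rw [← sum_proj_incl f]
    exact Fintype.sum_equiv e.symm _ _ fun _ => rfl

theorem exists_bicone (f : S.Obj) : ∃ (n : ℕ) (s : Fin n → S.Obj), (∀ i, Simple (s i)) ∧
    ∃ b : Limits.Bicone s, Nonempty b.IsBilimit ∧ Nonempty (f ≅ b.pt) := by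
  let e := Fintype.equivFin (Σ a : S.L, Fin (f a))
  refine ⟨_, fun i => delta (e.symm i).1, fun i => isSimpleFamily_delta.simple _,
    { pt := f
      ι := fun i => incl f (e.symm i)
      π := fun i => proj f (e.symm i)
      ι_π := fun i j => ?_ }, ⟨Limits.isBilimitOfTotal _ ?_⟩, ⟨Iso.refl f⟩⟩
  · split_ifs with h
    · subst h; exact incl_proj_self f _
    · exact incl_proj_ne f fun h' => h (e.symm.injective h')
  · refine Eq.trans ?_ (sum_proj_incl f)
    exact Fintype.sum_equiv e.symm _ _ fun _ => rfl

theorem skeletal : Skeletal S.Obj := by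
  rintro f g ⟨e⟩
  ext a
  have := (LinearEquiv.ofBijective (act e.hom a) (act_isIso_bijective e a)).finrank_eq
  simpa using this.symm

instance finite_hom (f g : S.Obj) : Module.Finite k (f ⟶ g) :=
  inferInstanceAs (Module.Finite k (∀ a : S.L, Matrix (Fin (g a)) (Fin (f a)) k))

/-- The interpretation of matrices as linear maps between finite-dimensional vector spaces, an
equivalence to the category of families of such spaces indexed by labels. -/
def toVect (S : FusionSystem.{t, w} k) : S.Obj ⥤ (Discrete S.L ⥤ FGModuleCat.{t} k) where
  obj f := Discrete.functor fun a => FGModuleCat.of k (Fin (f a) → k)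
  map {f g} A := Discrete.natTrans fun a => FGModuleCat.ofHom (Matrix.toLin' (Obj.mat A a.as))
  map_id f := by
    ext ⟨a⟩ : 2
    refine (congrArg FGModuleCat.ofHom Matrix.toLin'_one).trans rfl
  map_comp {f g h} A B := by
    ext ⟨a⟩ : 2
    refine (congrArg FGModuleCat.ofHom (Matrix.toLin'_mul (Obj.mat B a) (Obj.mat A a))).trans rfl

instance : (toVect S).Faithful where
  map_injective {f g A B} h := funext fun a => by
    have := NatTrans.congr_app h ⟨a⟩
    have h₂ : Matrix.toLin' (Obj.mat A a) = Matrix.toLin' (Obj.mat B a) :=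
      congrArg (fun φ => φ.hom.hom) this
    exact Matrix.toLin'.injective h₂

instance : (toVect S).Full where
  map_surjective {f g} φ := by
    refine ⟨fun a => LinearMap.toMatrix' (φ.app ⟨a⟩).hom.hom, ?_⟩
    ext ⟨a⟩ : 2
    exact congrArg FGModuleCat.ofHom (Matrix.toLin'_toMatrix' (φ.app ⟨a⟩).hom.hom)

instance : (toVect S).EssSurj where
  mem_essImage F := by
    refine ⟨⟨fun a => Module.finrank k (F.obj ⟨a⟩)⟩, ⟨Discrete.natIso fun a => ?_⟩⟩
    exact LinearEquiv.toFGModuleCatIso (Module.finBasis k (F.obj a)).equivFun.symm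

instance : (toVect S).IsEquivalence where

theorem exists_abelian : ∃ ab : Abelian S.Obj, ab.toPreadditive = (inferInstance : Preadditive S.Obj) := by
  have : Limits.HasFiniteProducts S.Obj :=
    ⟨fun n => Adjunction.hasLimitsOfShape_of_equivalence (toVect S)⟩
  exact ⟨abelianOfEquivalence (toVect S), rfl⟩

end FusionSystem

/-! ### Exact pairings from one zigzag identity, and of direct sums -/

section Duality

variable {C : Type u} [Category.{v} C] [MonoidalCategory C]

/-- One zigzag identity implies that the endomorphism in the other one does not change the
evaluation. -/
theorem whiskerLeft_zigzag_comp {X Y : C} (ev : X ⊗ Y ⟶ 𝟙_ C) (coev : 𝟙_ C ⟶ Y ⊗ X)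
    (h : X ◁ coev ≫ (α_ _ _ _).inv ≫ ev ▷ X = (ρ_ X).hom ≫ (λ_ X).inv) :
    X ◁ ((λ_ Y).inv ≫ coev ▷ Y ≫ (α_ _ _ _).hom ≫ Y ◁ ev ≫ (ρ_ Y).hom) ≫ ev = ev := by
  calc
    _ = 𝟙 _ ⊗≫ X ◁ coev ▷ Y ⊗≫ ((X ⊗ Y) ◁ ev ≫ ev ▷ 𝟙_ C) ⊗≫ 𝟙 _ := by monoidal
    _ = 𝟙 _ ⊗≫ X ◁ coev ▷ Y ⊗≫ (ev ▷ (X ⊗ Y) ≫ 𝟙_ C ◁ ev) ⊗≫ 𝟙 _ := by rw [whisker_exchange]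
    _ = 𝟙 _ ⊗≫ (X ◁ coev ≫ (α_ _ _ _).inv ≫ ev ▷ X) ▷ Y ⊗≫ ev := by monoidal
    _ = ev := by rw [h]; monoidal

variable [Preadditive C]

/-- If the endomorphisms of `Y` are scalars, then a single zigzag identity suffices for an exact
pairing. -/
@[reducible] def exactPairingOfZigzag {k : Type*} [Field k] [Linear k C] [MonoidalPreadditive C]
    [MonoidalLinear k C] {X Y : C} (ev : X ⊗ Y ⟶ 𝟙_ C) (coev : 𝟙_ C ⟶ Y ⊗ X) (h₀ : ev ≠ 0)
    (hY : ∀ f : Y ⟶ Y, ∃ r : k, f = r • 𝟙 Y)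
    (h : X ◁ coev ≫ (α_ _ _ _).inv ≫ ev ▷ X = (ρ_ X).hom ≫ (λ_ X).inv) : ExactPairing Y X where
  coevaluation' := coev
  evaluation' := ev
  coevaluation_evaluation' := h
  evaluation_coevaluation' := by
    have h₁ := whiskerLeft_zigzag_comp ev coev h
    obtain ⟨r, hr⟩ := hY ((λ_ Y).inv ≫ coev ▷ Y ≫ (α_ _ _ _).hom ≫ Y ◁ ev ≫ (ρ_ Y).hom)
    rw [hr] at h₁
    have h₂ : r • ev = (1 : k) • ev := by simpa using h₁
    have h₃ : r = 1 := smul_left_injective k h₀ h₂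
    rw [h₃, one_smul, Iso.inv_comp_eq, Category.comp_id] at hr
    rw [Iso.eq_comp_inv]
    simpa using hr

/-- A finite direct sum of objects with duals has the direct sum of the duals as its dual. -/
@[reducible] def exactPairingOfSum [MonoidalPreadditive C] {I : Type*} [Fintype I] {X Y : I → C}
    (p : ∀ i, ExactPairing (Y i) (X i)) {X' Y' : C} (ι : ∀ i, X i ⟶ X') (π : ∀ i, X' ⟶ X i)
    (κ : ∀ i, Y i ⟶ Y') (τ : ∀ i, Y' ⟶ Y i) (h₁ : ∀ i, ι i ≫ π i = 𝟙 _)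
    (h₂ : ∀ i j, i ≠ j → ι i ≫ π j = 0) (h₃ : ∑ i, π i ≫ ι i = 𝟙 X') (h₄ : ∀ i, κ i ≫ τ i = 𝟙 _)
    (h₅ : ∀ i j, i ≠ j → κ i ≫ τ j = 0) (h₆ : ∑ i, τ i ≫ κ i = 𝟙 Y') : ExactPairing Y' X' where
  coevaluation' := ∑ i, (p i).coevaluation' ≫ (κ i ⊗ₘ ι i)
  evaluation' := ∑ i, (π i ⊗ₘ τ i) ≫ (p i).evaluation'
  coevaluation_evaluation' := by
    have key : ∀ i j, X' ◁ ((p i).coevaluation' ≫ (κ i ⊗ₘ ι i)) ≫ (α_ _ _ _).inv ≫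
        ((π j ⊗ₘ τ j) ≫ (p j).evaluation') ▷ X' = X' ◁ (p i).coevaluation' ≫ (α_ _ _ _).inv ≫
          ((π j ⊗ₘ (κ i ≫ τ j)) ⊗ₘ ι i) ≫ (p j).evaluation' ▷ X' := by
      intro i j
      have : (X' ◁ (κ i ⊗ₘ ι i)) ≫ (α_ _ _ _).inv ≫ (π j ⊗ₘ τ j) ▷ X' =
          (α_ _ _ _).inv ≫ ((π j ⊗ₘ (κ i ≫ τ j)) ⊗ₘ ι i) := by
        rw [← id_tensorHom, associator_inv_naturality_assoc, ← tensorHom_id,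
          tensorHom_comp_tensorHom, tensorHom_comp_tensorHom, Category.id_comp, Category.comp_id]
      rw [whiskerLeft_comp, comp_whiskerRight, Category.assoc]
      exact congrArg (fun g => _ ◁ _ ≫ g) (by simpa using congrArg (fun g => g ≫ _ ▷ _) this)
    have diag : ∀ i, X' ◁ (p i).coevaluation' ≫ (α_ _ _ _).inv ≫
        ((π i ⊗ₘ 𝟙 (Y i)) ⊗ₘ ι i) ≫ (p i).evaluation' ▷ X' =
          (ρ_ X').hom ≫ (π i ≫ ι i) ≫ (λ_ X').inv := by
      intro i
      calc
        _ = X' ◁ (p i).coevaluation' ≫ (α_ _ _ _).inv ≫ (π i ▷ Y i) ▷ X i ≫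
              (X i ⊗ Y i) ◁ ι i ≫ (p i).evaluation' ▷ X' := by
            rw [MonoidalCategory.tensorHom_def, tensorHom_id, Category.assoc]
        _ = X' ◁ (p i).coevaluation' ≫ π i ▷ (Y i ⊗ X i) ≫ (α_ _ _ _).inv ≫
              (p i).evaluation' ▷ X i ≫ 𝟙_ C ◁ ι i := by
            rw [whisker_exchange, associator_inv_naturality_left_assoc]
        _ = π i ▷ 𝟙_ C ≫ (X i ◁ (p i).coevaluation' ≫ (α_ _ _ _).inv ≫
              (p i).evaluation' ▷ X i) ≫ 𝟙_ C ◁ ι i := by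
            rw [whisker_exchange_assoc]; simp only [Category.assoc]
        _ = _ := by
            rw [(p i).coevaluation_evaluation']; simp
    rw [whiskerLeft_sum, sum_whiskerRight, Preadditive.sum_comp]
    simp only [Preadditive.comp_sum, key]
    -- The terms off the diagonal contain `κ i ≫ τ j = 0`.
    have off : ∀ i, ∀ j ∈ Finset.univ, j ≠ i → X' ◁ (p i).coevaluation' ≫ (α_ _ _ _).inv ≫
        ((π j ⊗ₘ (κ i ≫ τ j)) ⊗ₘ ι i) ≫ (p j).evaluation' ▷ X' = 0 := by
      intro i j _ hij
      simp [h₅ i j hij.symm]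
    simp only [fun i => Finset.sum_eq_single i (off i) (by simp), h₄, diag]
    rw [← Preadditive.comp_sum, ← Preadditive.sum_comp, h₃, Category.id_comp]
  evaluation_coevaluation' := by
    have key : ∀ i j, ((p i).coevaluation' ≫ (κ i ⊗ₘ ι i)) ▷ Y' ≫ (α_ _ _ _).hom ≫
        Y' ◁ ((π j ⊗ₘ τ j) ≫ (p j).evaluation') = (p i).coevaluation' ▷ Y' ≫ (α_ _ _ _).hom ≫
          (κ i ⊗ₘ ((ι i ≫ π j) ⊗ₘ τ j)) ≫ Y' ◁ (p j).evaluation' := by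
      intro i j
      have : ((κ i ⊗ₘ ι i) ▷ Y') ≫ (α_ _ _ _).hom ≫ Y' ◁ (π j ⊗ₘ τ j) =
          (α_ _ _ _).hom ≫ (κ i ⊗ₘ ((ι i ≫ π j) ⊗ₘ τ j)) := by
        rw [← tensorHom_id, associator_naturality_assoc, ← id_tensorHom,
          tensorHom_comp_tensorHom, tensorHom_comp_tensorHom, Category.id_comp, Category.comp_id]
      rw [whiskerLeft_comp, comp_whiskerRight, Category.assoc]
      exact congrArg (fun g => _ ▷ _ ≫ g) (by simpa using congrArg (fun g => g ≫ _ ◁ _) this)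
    have diag : ∀ i, (p i).coevaluation' ▷ Y' ≫ (α_ _ _ _).hom ≫
        (κ i ⊗ₘ (𝟙 (X i) ⊗ₘ τ i)) ≫ Y' ◁ (p i).evaluation' =
          (λ_ Y').hom ≫ (τ i ≫ κ i) ≫ (ρ_ Y').inv := by
      intro i
      calc
        _ = (p i).coevaluation' ▷ Y' ≫ (α_ _ _ _).hom ≫ Y i ◁ (X i ◁ τ i) ≫
              κ i ▷ (X i ⊗ Y i) ≫ Y' ◁ (p i).evaluation' := by
            rw [MonoidalCategory.tensorHom_def', id_tensorHom, Category.assoc]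
        _ = (p i).coevaluation' ▷ Y' ≫ (Y i ⊗ X i) ◁ τ i ≫ (α_ _ _ _).hom ≫
              Y i ◁ (p i).evaluation' ≫ κ i ▷ 𝟙_ C := by
            rw [← whisker_exchange, associator_naturality_right_assoc]
        _ = 𝟙_ C ◁ τ i ≫ ((p i).coevaluation' ▷ Y i ≫ (α_ _ _ _).hom ≫
              Y i ◁ (p i).evaluation') ≫ κ i ▷ 𝟙_ C := by
            rw [← whisker_exchange_assoc]; simp only [Category.assoc]
        _ = _ := by
            rw [(p i).evaluation_coevaluation']; simp
    rw [whiskerLeft_sum, sum_whiskerRight, Preadditive.sum_comp]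
    simp only [Preadditive.comp_sum, key]
    have off : ∀ i, ∀ j ∈ Finset.univ, j ≠ i → (p i).coevaluation' ▷ Y' ≫ (α_ _ _ _).hom ≫
        (κ i ⊗ₘ ((ι i ≫ π j) ⊗ₘ τ j)) ≫ Y' ◁ (p j).evaluation' = 0 := by
      intro i j _ hij
      simp [h₂ i j hij.symm]
    simp only [fun i => Finset.sum_eq_single i (off i) (by simp), h₁, diag]
    rw [← Preadditive.comp_sum, ← Preadditive.sum_comp, h₆, Category.id_comp]

end Duality

namespace IsSimpleFamily

variable {k : Type t} [Field k] {C : Type u} [Category.{v} C] [Preadditive C] [Linear k C]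
  [MonoidalCategory C] [MonoidalPreadditive C]

/-- In a family of composites `X a ⊗ X b ⟶ X c` whose associativity constraint is given by
matrices `F`, the zigzag of `η_{a a*}^1` is the number `F_{a a* a}^a [1 1 1; 1 1 1]`. -/
theorem zigzag_eq {R : FusionRuleData.{w}} {X : R.L → C} (hX : IsSimpleFamily k X)
    (hone : X R.one = 𝟙_ C) (η : ∀ a b c, Fin (R.N a b c) → (X a ⊗ X b ⟶ X c))
    (F : R.FMatrices k) {a b : R.L} (i : Fin (R.N a b R.one)) (j : Fin (R.N R.one a a))
    (i' : Fin (R.N a R.one a)) (j' : Fin (R.N b a R.one)) [Subsingleton (Fin (R.N a R.one a))]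
    [Subsingleton (Fin (R.N b a R.one))]
    (hF : (α_ (X a) (X b) (X a)).inv ≫ (η a b R.one i ▷ X a) ≫ η R.one a a j =
      ∑ e' : R.L, ∑ i' : Fin (R.N a e' a), ∑ j' : Fin (R.N b a e'),
        F.entry i j i' j' • ((X a ◁ η b a e' j') ≫ η a e' a i'))
    (coev : 𝟙_ C ⟶ X b ⊗ X a) :
    X a ◁ coev ≫ (α_ (X a) (X b) (X a)).inv ≫ (η a b R.one i ▷ X a) ≫ η R.one a a j =
      F.entry i j i' j' • (X a ◁ (coev ≫ η b a R.one j') ≫ η a R.one a i') := by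
  rw [hF]
  simp only [Preadditive.comp_sum, Linear.comp_smul, ← whiskerLeft_comp_assoc]
  rw [Finset.sum_eq_single R.one, Fintype.sum_subsingleton _ i', Fintype.sum_subsingleton _ j']
  · intro e _ he
    refine Finset.sum_eq_zero fun x _ => Finset.sum_eq_zero fun y _ => ?_
    have h₁ : eqToHom hone ≫ coev ≫ η b a e y = 0 := hX.hom_eq_zero (Ne.symm he) _
    have h₂ : coev ≫ η b a e y = 0 := by
      simpa using congrArg (fun g => eqToHom hone.symm ≫ g) h₁
    rw [h₂, MonoidalPreadditive.whiskerLeft_zero, Limits.zero_comp, smul_zero]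
  · simp

/-- The zigzag of the evaluation `η_{a a*}^1` with a coevaluation that is dual to `η_{a* a}^1`. -/
theorem zigzag_eq_smul {R : FusionRuleData.{w}} {X : R.L → C} (hX : IsSimpleFamily k X)
    (hone : X R.one = 𝟙_ C) (η : ∀ a b c, Fin (R.N a b c) → (X a ⊗ X b ⟶ X c))
    (F : R.FMatrices k) {a b : R.L} (i : Fin (R.N a b R.one)) (j : Fin (R.N R.one a a))
    (i' : Fin (R.N a R.one a)) (j' : Fin (R.N b a R.one)) [Subsingleton (Fin (R.N a R.one a))]
    [Subsingleton (Fin (R.N b a R.one))]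
    (hF : (α_ (X a) (X b) (X a)).inv ≫ (η a b R.one i ▷ X a) ≫ η R.one a a j =
      ∑ e' : R.L, ∑ i' : Fin (R.N a e' a), ∑ j' : Fin (R.N b a e'),
        F.entry i j i' j' • ((X a ◁ η b a e' j') ≫ η a e' a i'))
    (hl : η R.one a a j = eqToHom hone ▷ X a ≫ (λ_ (X a)).hom)
    (hr : η a R.one a i' = X a ◁ eqToHom hone ≫ (ρ_ (X a)).hom)
    (coev : 𝟙_ C ⟶ X b ⊗ X a) (hc : coev ≫ η b a R.one j' = eqToHom hone.symm) :
    X a ◁ coev ≫ (α_ (X a) (X b) (X a)).inv ≫ ((η a b R.one i ≫ eqToHom hone) ▷ X a) =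
      F.entry i j i' j' • ((ρ_ (X a)).hom ≫ (λ_ (X a)).inv) := by
  have h := hX.zigzag_eq hone η F i j i' j' hF coev
  rw [hc, hr, hl, ← whiskerLeft_comp_assoc, eqToHom_trans, eqToHom_refl, whiskerLeft_id,
    Category.id_comp, ← comp_whiskerRight_assoc] at h
  rw [← Linear.smul_comp, Iso.eq_comp_inv, ← h]
  simp only [Category.assoc]

end IsSimpleFamily

/-! ### `C(L, N, F)` is rigid, hence a fusion category -/

namespace FusionSystem

variable {k : Type t} [Field k] {S : FusionSystem.{t, w} k}

theorem tensHom_zero {f f' g g' : S.Obj} (A : f ⟶ f') : tensHom A (0 : g ⟶ g') = 0 :=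
  hom_ext fun c => tens_ext fun a b i v w => by simp [act_tensHom, act_zero]

theorem zero_tensHom {f f' g g' : S.Obj} (B : g ⟶ g') : tensHom (0 : f ⟶ f') B = 0 :=
  hom_ext fun c => tens_ext fun a b i v w => by simp [act_tensHom, act_zero]

theorem tensHom_add {f f' g g' : S.Obj} (A : f ⟶ f') (B B' : g ⟶ g') :
    tensHom A (B + B') = tensHom A B + tensHom A B' :=
  hom_ext fun c => tens_ext fun a b i v w => by simp [act_tensHom, act_add]

theorem add_tensHom {f f' g g' : S.Obj} (A A' : f ⟶ f') (B : g ⟶ g') :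
    tensHom (A + A') B = tensHom A B + tensHom A' B :=
  hom_ext fun c => tens_ext fun a b i v w => by simp [act_tensHom, act_add]

theorem tensHom_smul {f f' g g' : S.Obj} (A : f ⟶ f') (r : k) (B : g ⟶ g') :
    tensHom A (r • B) = r • tensHom A B :=
  hom_ext fun c => tens_ext fun a b i v w => by simp [act_tensHom, act_smul]

theorem smul_tensHom {f f' g g' : S.Obj} (r : k) (A : f ⟶ f') (B : g ⟶ g') :
    tensHom (r • A) B = r • tensHom A B :=
  hom_ext fun c => tens_ext fun a b i v w => by simp [act_tensHom, act_smul]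

section

attribute [local instance] monoidalCategory

theorem monoidalPreadditive : MonoidalPreadditive S.Obj where
  whiskerLeft_zero := tensHom_zero _
  zero_whiskerRight := zero_tensHom _
  whiskerLeft_add := tensHom_add _
  add_whiskerRight A B := add_tensHom A B _

attribute [local instance] monoidalPreadditive

theorem monoidalLinear : MonoidalLinear k S.Obj where
  whiskerLeft_smul _ _ _ := tensHom_smul _
  smul_whiskerRight r _ _ A _ := smul_tensHom r A _

attribute [local instance] monoidalLinear

/-- The coordinate covector of `δ_a`. -/
def deltaCov (a : S.L) : Cov (delta a) a := fun _ => 1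

theorem delta_hom_ext {f : S.Obj} {c : S.L} {A B : f ⟶ delta c}
    (h : act A c (deltaCov c) = act B c (deltaCov c)) : A = B := by
  refine funext fun b => Matrix.ext fun x y => ?_
  obtain rfl := eq_of_fin_delta x
  have hx : (deltaCov c : Cov (delta c) c) = Pi.single x 1 := by
    funext y
    obtain rfl := Subsingleton.elim x y
    simp [deltaCov]
  rw [hx, act_single, act_single] at h
  exact congrFun h y

/-- The morphism to `δ_c` which is given by a covector. -/
def toDelta {f : S.Obj} {c : S.L} (x : Cov f c) : f ⟶ delta c :=
  ofAct fun b => if h : c = b then h ▸ (LinearMap.proj (Classical.arbitrary _)).smulRight x else 0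

@[simp] theorem act_toDelta {f : S.Obj} {c : S.L} (x : Cov f c) :
    act (toDelta x) c (deltaCov c) = x := by
  rw [toDelta, act_ofAct, dif_pos rfl]
  simp [deltaCov]

/-- The morphisms `η_{ab}^{c,i} : δ_a ⊗ δ_b ⟶ δ_c` which correspond to the basis labels. -/
def deltaη (a b c : S.L) (i : Fin (S.N a b c)) : (delta a ⊗ delta b : S.Obj) ⟶ delta c :=
  toDelta (tens a b c i (deltaCov a) (deltaCov b))

theorem act_deltaη (a b c : S.L) (i : Fin (S.N a b c)) :
    act (deltaη a b c i) c (deltaCov c) = tens a b c i (deltaCov a) (deltaCov b) :=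
  act_toDelta _

theorem deltaη_ne_zero (a b c : S.L) (i : Fin (S.N a b c)) : deltaη a b c i ≠ 0 := by
  intro h
  have h₁ := act_deltaη a b c i
  rw [h, act_zero] at h₁
  have hs : ∀ a : S.L, (deltaCov a : Cov (delta a) a) = Pi.single (Classical.arbitrary _) 1 := by
    intro a
    funext y
    obtain rfl := Subsingleton.elim (Classical.arbitrary _) y
    simp [deltaCov]
  rw [hs a, hs b, tens_single] at h₁
  have h₂ := congrFun h₁ ((idx (delta a) (delta b) c).symm
    ⟨(a, b), Classical.arbitrary _, Classical.arbitrary _, i⟩)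
  exact zero_ne_one (h₂.trans (Pi.single_eq_same _ _))

theorem act_sum {f g : S.Obj} {ι : Type*} (s : Finset ι) (A : ι → (f ⟶ g)) (a : S.L) :
    act (∑ i ∈ s, A i) a = ∑ i ∈ s, act (A i) a :=
  map_sum (⟨⟨fun A => act A a, act_zero a⟩, fun A B => act_add A B a⟩ :
    (f ⟶ g) →+ (Cov g a →ₗ[k] Cov f a)) A s

theorem act_deltaη_comp_left (a b c u e : S.L) (i : Fin (S.N a b e)) (j : Fin (S.N e c u)) :
    act ((deltaη a b e i ▷ delta c) ≫ deltaη e c u j) u (deltaCov u) =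
      tens e c u j (tens a b e i (deltaCov a) (deltaCov b)) (deltaCov c) := by
  rw [act_comp_apply, act_deltaη, ← act_deltaη a b e i]
  refine (act_tensHom _ _ _ _ _).trans ?_
  rw [act_id]; rfl

theorem act_deltaη_comp_right (a b c u e : S.L) (i : Fin (S.N a e u)) (j : Fin (S.N b c e)) :
    act ((delta a ◁ deltaη b c e j) ≫ deltaη a e u i) u (deltaCov u) =
      tens a e u i (deltaCov a) (tens b c e j (deltaCov b) (deltaCov c)) := by
  rw [act_comp_apply, act_deltaη, ← act_deltaη b c e j]
  refine (act_tensHom _ _ _ _ _).trans ?_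
  rw [act_id]; rfl

/-- The associativity isomorphism is given on the morphisms `η_{ab}^{c,i}` by the matrices `F`. -/
theorem deltaη_assoc (a b c u e : S.L) (i : Fin (S.N a b e)) (j : Fin (S.N e c u)) :
    (α_ (delta a) (delta b) (delta c)).inv ≫ (deltaη a b e i ▷ delta c) ≫ deltaη e c u j =
      ∑ e' : S.L, ∑ i' : Fin (S.N a e' u), ∑ j' : Fin (S.N b c e'),
        S.F.entry i j i' j' • ((delta a ◁ deltaη b c e' j') ≫ deltaη a e' u i') := by
  refine delta_hom_ext ?_
  rw [act_comp_apply, act_deltaη_comp_left]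
  simp only [act_sum, act_smul, LinearMap.sum_apply, LinearMap.smul_apply, act_deltaη_comp_right]
  exact act_assoc _ _ _ i j _ _ _

theorem delta_one : (delta S.R.one : S.Obj) = 𝟙_ S.Obj := rfl

theorem deltaη_one_left (a : S.L) (i : Fin (S.N S.R.one a a)) :
    deltaη S.R.one a a i = eqToHom delta_one ▷ delta a ≫ (λ_ (delta a)).hom := by
  refine delta_hom_ext ?_
  rw [act_deltaη, act_comp_apply]
  refine (act_leftUnitor (delta a) i _).symm.trans ?_
  exact (congrFun (congrArg DFunLike.coe (act_id (tensObj (delta S.R.one) (delta a)) a)) _).symm.trans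
    (congrArg (fun A => act A a _) (id_whiskerRight (𝟙_ S.Obj) (delta a)).symm)

theorem deltaη_one_right (a : S.L) (i : Fin (S.N a S.R.one a)) :
    deltaη a S.R.one a i = delta a ◁ eqToHom delta_one ≫ (ρ_ (delta a)).hom := by
  refine delta_hom_ext ?_
  rw [act_deltaη, act_comp_apply]
  refine (act_rightUnitor (delta a) i _).symm.trans ?_
  exact (congrFun (congrArg DFunLike.coe (act_id (tensObj (delta a) (delta S.R.one)) a)) _).symm.trans
    (congrArg (fun A => act A a _) (whiskerLeft_id (delta a) (𝟙_ S.Obj)).symm)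

/-- The object `δ_{a*}` is a dual of `δ_a`: since `F_{a a* a}^a [1 1 1; 1 1 1] ≠ 0`, a zigzag identity
holds after rescaling the coevaluation. -/
@[reducible] def deltaPairing (a : S.L) :
    ExactPairing (delta (S.R.star a) : S.Obj) (delta a) := by
  let b := S.R.star a
  have hS := S.isFusionSystem
  have e₁ : S.N a b S.R.one = 1 := by simp [N, hS.N_dual, b]
  have e₂ : S.N b a S.R.one = 1 := by simp [N, hS.N_dual, b, hS.star_star]
  have e₃ : S.N a S.R.one a = 1 := by simp [N, hS.N_one_right]
  have e₄ : S.N S.R.one a a = 1 := by simp [N, hS.N_one_left]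
  have : Subsingleton (Fin (S.R.N b a S.R.one)) := by
    rw [show S.R.N b a S.R.one = 1 from e₂]; infer_instance
  have : Subsingleton (Fin (S.R.N a S.R.one a)) := by
    rw [show S.R.N a S.R.one a = 1 from e₃]; infer_instance
  let i : Fin (S.N a b S.R.one) := ⟨0, by omega⟩
  let j' : Fin (S.N b a S.R.one) := ⟨0, by omega⟩
  let i' : Fin (S.N a S.R.one a) := ⟨0, by omega⟩
  let j : Fin (S.N S.R.one a a) := ⟨0, by omega⟩
  have hsec := isSimpleFamily_delta.exists_section (deltaη_ne_zero b a S.R.one j')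
  let r := S.F.entry i j i' j'
  have hr : r ≠ 0 := hS.duality a i j i' j'
  refine exactPairingOfZigzag (k := k) (deltaη a b S.R.one i ≫ eqToHom delta_one)
    (r⁻¹ • (eqToHom delta_one.symm ≫ hsec.choose)) (fun h => deltaη_ne_zero a b S.R.one i ?_)
    (isSimpleFamily_delta.end_eq_smul b) ?_
  · simpa using congrArg (fun g => g ≫ eqToHom delta_one.symm) h
  · rw [MonoidalLinear.whiskerLeft_smul, Linear.smul_comp,
      isSimpleFamily_delta.zigzag_eq_smul (R := S.R) (X := delta) delta_one deltaη S.F i j i' j'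
        (deltaη_assoc _ _ _ _ _ i j) (deltaη_one_left a j) (deltaη_one_right a i')
        (eqToHom delta_one.symm ≫ hsec.choose)
        (by rw [Category.assoc, hsec.choose_spec, Category.comp_id]),
      smul_smul, inv_mul_cancel₀ hr, one_smul]

/-- The dual object `f*`, with `f*(a) = f(a*)`. -/
def dualObj (f : S.Obj) : S.Obj := ⟨fun a => f (S.R.star a)⟩

/-- The bijection between the simple summands of `f*` and of `f`. -/
def dualSummand (f : S.Obj) (p : Σ a : S.L, Fin (dualObj f a)) : Σ a : S.L, Fin (f a) :=
  ⟨S.R.star p.1, p.2⟩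

theorem dualSummand_bijective (f : S.Obj) : Function.Bijective (dualSummand f) := by
  have hs := S.isFusionSystem.star_star
  constructor
  · rintro ⟨a, m⟩ ⟨b, n⟩ h
    obtain ⟨h₁, h₂⟩ := Sigma.mk.inj h
    obtain rfl : a = b := by rw [← hs a, ← hs b]; exact congrArg _ h₁
    exact congrArg (Sigma.mk a) (eq_of_heq h₂)
  · rintro ⟨a, m⟩
    obtain ⟨b, rfl⟩ : ∃ b, S.R.star b = a := ⟨_, hs a⟩
    exact ⟨⟨b, m⟩, rfl⟩

theorem sum_dualSummand (f : S.Obj) :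
    ∑ p, proj f (dualSummand f p) ≫ incl f (dualSummand f p) = 𝟙 f :=
  ((dualSummand_bijective f).sum_comp fun p => proj f p ≫ incl f p).trans (sum_proj_incl f)

theorem rigid : Nonempty (RigidCategory S.Obj) := by
  have left : ∀ f : S.Obj, Nonempty (ExactPairing (dualObj f) f) := fun f => by
    have hp : ∀ b : S.L, Nonempty (ExactPairing (delta b : S.Obj) (delta (S.R.star b))) := fun b => by
      have := deltaPairing (S.R.star b)
      rw [S.isFusionSystem.star_star] at this
      exact ⟨this⟩
    exact ⟨exactPairingOfSum (fun p : Σ a : S.L, Fin (dualObj f a) => (hp p.1).some)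
      (fun p => incl f (dualSummand f p)) (fun p => proj f (dualSummand f p))
      (incl (dualObj f)) (proj (dualObj f)) (fun p => incl_proj_self _ _)
      (fun p q h => incl_proj_ne _ fun h' => h ((dualSummand_bijective f).1 h'))
      (sum_dualSummand f) (fun p => incl_proj_self _ _) (fun p q h => incl_proj_ne _ h)
      (sum_proj_incl _)⟩
  have right : ∀ f : S.Obj, Nonempty (ExactPairing f (dualObj f)) := fun f =>
    ⟨exactPairingOfSum (fun p : Σ a : S.L, Fin (dualObj f a) => deltaPairing p.1)
      (incl (dualObj f)) (proj (dualObj f)) (fun p => incl f (dualSummand f p))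
      (fun p => proj f (dualSummand f p)) (fun p => incl_proj_self _ _)
      (fun p q h => incl_proj_ne _ h) (sum_proj_incl _) (fun p => incl_proj_self _ _)
      (fun p q h => incl_proj_ne _ fun h' => h ((dualSummand_bijective f).1 h'))
      (sum_dualSummand f)⟩
  exact ⟨{ rightDual := fun f => { rightDual := dualObj f, exact := (right f).some }
           leftDual := fun f => { leftDual := dualObj f, exact := (left f).some } }⟩

theorem unit_simple : Simple (𝟙_ S.Obj) := isSimpleFamily_delta.simple S.R.one

variable (S) in
theorem isFusionCategory : IsFusionCategory k S.Obj := by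
  obtain ⟨ab, hab⟩ := exists_abelian (S := S)
  have hk : Limits.HasKernels S.Obj := by
    have := ab.has_kernels
    rw [hab] at this
    exact this
  exact
  { abelian := ⟨ab, hab⟩
    finite_hom := finite_hom
    monoidalPreadditive := monoidalPreadditive
    monoidalLinear := monoidalLinear
    rigid := rigid
    semisimple := exists_bicone
    finite_simple := by
      let e := Fintype.equivFin S.L
      refine ⟨_, fun i => delta (e.symm i), fun f _ => ?_⟩
      obtain ⟨a, h⟩ := isSimpleFamily_delta.exists_iso_of_simple f
      exact ⟨e a, by
        change Nonempty (f ≅ delta (e.symm (e a)))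
        rwa [e.symm_apply_apply]⟩
    unit_simple := unit_simple
    end_simple := fun f _ => isSimpleFamily_delta.bijective_smul_id f }

variable (S) in
theorem isStrictlyUnital : IsStrictlyUnital S.Obj := fun f =>
  ⟨⟨unit_tensObj f, rfl⟩, ⟨tensObj_unit f, rfl⟩⟩

end

end FusionSystem

/-! ### Simple objects, duals and multiplicities of a fusion category -/

section

variable {C : Type u} [Category.{v} C] [MonoidalCategory C]

/-- An exact pairing identifies morphisms into the dual with pairings. -/
theorem whiskerLeft_comp_evaluation_bijective {X Y : C} (p : ExactPairing Y X) (W : C) :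
    Function.Bijective fun f : W ⟶ Y => X ◁ f ≫ p.evaluation' := by
  let _ : HasLeftDual X := ⟨Y⟩
  have h : ∀ f : W ⟶ Y, X ◁ f ≫ p.evaluation' =
      (tensorLeftHomEquiv W Y X (𝟙_ C)).symm (f ≫ (ρ_ Y).inv) := fun f => by
    rw [Equiv.eq_symm_apply]
    exact tensorLeftHomEquiv_whiskerLeft_comp_evaluation (Z := X) (show W ⟶ ᘁX from f)
  rw [funext h]
  exact (tensorLeftHomEquiv W Y X (𝟙_ C)).symm.bijective.comp
    ⟨fun f g hfg => (cancel_mono (ρ_ Y).inv).1 hfg, fun g => ⟨g ≫ (ρ_ Y).hom, by simp⟩⟩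

variable [Preadditive C] [MonoidalPreadditive C]

theorem evaluation_ne_zero {X Y : C} (p : ExactPairing Y X) (h : 𝟙 X ≠ 0) :
    p.evaluation' ≠ 0 := by
  intro h₀
  have h₁ := p.coevaluation_evaluation'
  rw [h₀] at h₁
  simp only [MonoidalPreadditive.zero_whiskerRight, Limits.comp_zero] at h₁
  refine h ?_
  have h₂ := congrArg (fun g => (ρ_ X).inv ≫ g ≫ (λ_ X).hom) h₁
  simpa using h₂.symm

theorem id_ne_zero_of_exactPairing {X Y : C} (p : ExactPairing Y X) (h : 𝟙 X ≠ 0) :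
    𝟙 Y ≠ 0 := by
  intro h₀
  have h₁ : X ◁ (𝟙 Y) ≫ p.evaluation' = 0 := by rw [h₀]; simp
  exact evaluation_ne_zero p h (by simpa using h₁)

/-- If the endomorphisms of an object are scalars, then so are those of its dual. -/
theorem end_eq_smul_of_exactPairing {k : Type*} [Field k] [Linear k C] [MonoidalLinear k C]
    {X Y : C} (p : ExactPairing Y X) (h : ∀ f : X ⟶ X, ∃ r : k, f = r • 𝟙 X) (f : Y ⟶ Y) :
    ∃ r : k, f = r • 𝟙 Y := by
  let _ : HasRightDual Y := ⟨X⟩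
  obtain ⟨g, hg⟩ : ∃ g : X ⟶ X, X ◁ f ≫ p.evaluation' = g ▷ Y ≫ p.evaluation' :=
    ⟨fᘁ, (rightAdjointMate_comp_evaluation f).symm⟩
  obtain ⟨r, rfl⟩ := h g
  refine ⟨r, (whiskerLeft_comp_evaluation_bijective p Y).1 ?_⟩
  change X ◁ f ≫ p.evaluation' = X ◁ (r • 𝟙 Y) ≫ p.evaluation'
  rw [hg]
  simp

end

section

variable {C : Type u} [Category.{v} C] [MonoidalCategory C] {Z : C} (h : Z = 𝟙_ C)

/-- The left unit isomorphism of an object that is equal to the neutral object. -/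
def leftUnitorOfEq (W : C) : Z ⊗ W ≅ W := whiskerRightIso (eqToIso h) W ≪≫ λ_ W

/-- The right unit isomorphism of an object that is equal to the neutral object. -/
def rightUnitorOfEq (W : C) : W ⊗ Z ≅ W := whiskerLeftIso W (eqToIso h) ≪≫ ρ_ W

theorem leftUnitorOfEq_eq_rightUnitorOfEq :
    (leftUnitorOfEq h Z).hom = (rightUnitorOfEq h Z).hom := by
  subst h
  simp [leftUnitorOfEq, rightUnitorOfEq, unitors_equal]

theorem exists_exactPairing_of_eq :
    ∃ p : ExactPairing Z Z, p.evaluation' ≫ eqToHom h.symm = (leftUnitorOfEq h Z).hom := by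
  subst h
  exact ⟨exactPairingUnit, by
    change (ρ_ (𝟙_ C)).hom ≫ _ = _
    simp [leftUnitorOfEq, unitors_equal]⟩

end

namespace IsFusionCategory

variable {k : Type t} [Field k] {C : Type u} [Category.{v} C] [Preadditive C] [Linear k C]
  [MonoidalCategory C] (hC : IsFusionCategory k C)

include hC

theorem hasKernels : Limits.HasKernels C := by
  obtain ⟨ab, hab⟩ := hC.abelian
  have := ab.has_kernels
  rw [hab] at this
  exact this

theorem hasFiniteBiproducts : Limits.HasFiniteBiproducts C := by
  obtain ⟨ab, hab⟩ := hC.abelian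
  have : Limits.HasFiniteProducts C := ab.has_finite_products
  exact Limits.HasFiniteBiproducts.of_hasFiniteProducts

/-- Representatives of the isomorphism classes of simple objects form a simple family. -/
theorem isSimpleFamily {L : Type w} {X : L → C} (hs : ∀ a, Simple (X a))
    (h₁ : ∀ a b, Nonempty (X a ≅ X b) → a = b) (h₂ : ∀ Y : C, Simple Y → ∃ a, Nonempty (Y ≅ X a)) :
    IsSimpleFamily k X where
  end_eq_smul a f := by
    obtain ⟨r, hr⟩ := (hC.end_simple (X a) (hs a)).2 f
    exact ⟨r, hr.symm⟩
  id_ne_zero a := by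
    have := hs a
    exact id_nonzero (X a)
  hom_eq_zero {a b} hab f := by
    by_contra hf
    have := hs a
    have := hs b
    have := hC.hasKernels
    have := isIso_of_hom_simple hf
    exact hab (h₁ a b ⟨asIso f⟩)
  decomp Y := by
    obtain ⟨n, s, h, b, ⟨hb⟩, ⟨e⟩⟩ := hC.semisimple Y
    choose l i using fun j => h₂ (s j) (h j)
    refine ⟨n, l, fun j => (i j).some.inv ≫ b.ι j ≫ e.inv, fun j => e.hom ≫ b.π j ≫ (i j).some.hom, ?_⟩
    have : ∑ j, e.hom ≫ (b.π j ≫ b.ι j) ≫ e.inv = 𝟙 Y := by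
      rw [← Preadditive.comp_sum, ← Preadditive.sum_comp, Limits.IsBilimit.total hb, Category.id_comp, e.hom_inv_id]
    simpa using this

/-- A set of representatives of the isomorphism classes of simple objects which contains the neutral
object. -/
theorem exists_representatives : ∃ (L : Type w) (_ : Fintype L) (X : L → C) (o : L),
    (∀ a, Simple (X a)) ∧ (∀ a b, Nonempty (X a ≅ X b) → a = b) ∧
    (∀ Y : C, Simple Y → ∃ a, Nonempty (Y ≅ X a)) ∧ X o = 𝟙_ C := by
  classical
  obtain ⟨n, s, hs⟩ := hC.finite_simple
  -- The list `s` may contain repetitions and objects that are not simple: keep the first entry of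
  -- each isomorphism class of simple objects.
  let I : Type := {i : Fin n // Simple (s i) ∧ ∀ j < i, IsEmpty (s j ≅ s i)}
  have hI : ∀ Y : C, Simple Y → ∃ i : I, Nonempty (Y ≅ s i.1) := fun Y hY => by
    have hne : (Finset.univ.filter fun i => Nonempty (Y ≅ s i)).Nonempty := by
      obtain ⟨i, hi⟩ := hs Y hY
      exact ⟨i, by simpa using hi⟩
    obtain ⟨i, hi, hmin⟩ := Finset.exists_minimal hne
    simp only [Finset.mem_filter, Finset.mem_univ, true_and] at hi hmin
    obtain ⟨e⟩ := hi
    refine ⟨⟨i, Simple.of_iso e.symm, fun j hj => ⟨fun e' => ?_⟩⟩, ⟨e⟩⟩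
    exact absurd (hmin ⟨e ≪≫ e'.symm⟩ hj.le) (not_le.2 hj)
  have hI' : ∀ i j : I, Nonempty (s i.1 ≅ s j.1) → i = j := by
    rintro ⟨i, hi⟩ ⟨j, hj⟩ ⟨e⟩
    rcases lt_trichotomy i j with h | h | h
    · exact ((hj.2 i h).false e).elim
    · exact Subtype.ext h
    · exact ((hi.2 j h).false e.symm).elim
  -- The representative of the class of the neutral object has to be the neutral object itself.
  let X : I → C := fun i => if Nonempty (s i.1 ≅ 𝟙_ C) then 𝟙_ C else s i.1
  have hX : ∀ i, Nonempty (X i ≅ s i.1) := fun i => by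
    by_cases h : Nonempty (s i.1 ≅ 𝟙_ C)
    · simp only [X, if_pos h]; exact ⟨h.some.symm⟩
    · simp only [X, if_neg h]; exact ⟨Iso.refl _⟩
  obtain ⟨o, ⟨ho⟩⟩ := hI (𝟙_ C) hC.unit_simple
  refine ⟨ULift.{w} I, inferInstance, fun a => X a.down, ⟨o⟩, fun a => ?_, fun a b ⟨e⟩ => ?_,
    fun Y hY => ?_, if_pos ⟨ho.symm⟩⟩
  · have := a.down.2.1
    exact Simple.of_iso (hX a.down).some
  · exact ULift.ext _ _ (hI' _ _ ⟨(hX a.down).some.symm ≪≫ e ≪≫ (hX b.down).some⟩)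
  · obtain ⟨i, ⟨e⟩⟩ := hI Y hY
    exact ⟨⟨i⟩, ⟨e ≪≫ (hX i).some.symm⟩⟩

theorem exists_exactPairing {L : Type w} {X : L → C} (hX : IsSimpleFamily k X) (a : L) :
    ∃ b, Nonempty (ExactPairing (X b) (X a)) := by
  have := hC.monoidalPreadditive
  have := hC.monoidalLinear
  obtain ⟨hr⟩ := hC.rigid
  let Y := hr.leftDual (X a)
  let p : ExactPairing Y.leftDual (X a) := Y.exact
  obtain ⟨b, ⟨e⟩⟩ := hX.exists_iso_of_end (id_ne_zero_of_exactPairing p (hX.id_ne_zero a))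
    (end_eq_smul_of_exactPairing p (hX.end_eq_smul a))
  exact ⟨b, ⟨exactPairingCongrLeft e.symm⟩⟩

end IsFusionCategory

namespace IsSimpleFamily

variable {k : Type t} [Field k] {C : Type u} [Category.{v} C] [Preadditive C] [Linear k C]
  [MonoidalCategory C] {L : Type w} [DecidableEq L] {X : L → C} (hX : IsSimpleFamily k X) {o : L} (ho : X o = 𝟙_ C)

include hX ho

theorem finrank_unit_left (a b : L) :
    Module.finrank k (X o ⊗ X a ⟶ X b) = if a = b then 1 else 0 := by
  rw [← hX.finrank_hom a b]
  exact (Linear.homCongr k (leftUnitorOfEq ho (X a)) (Iso.refl (X b))).finrank_eq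

theorem finrank_unit_right (a b : L) :
    Module.finrank k (X a ⊗ X o ⟶ X b) = if a = b then 1 else 0 := by
  rw [← hX.finrank_hom a b]
  exact (Linear.homCongr k (rightUnitorOfEq ho (X a)) (Iso.refl (X b))).finrank_eq

theorem finrank_dual [MonoidalPreadditive C] [MonoidalLinear k C] {a a' : L} (p : ExactPairing (X a') (X a)) (b : L) :
    Module.finrank k (X a ⊗ X b ⟶ X o) = if a' = b then 1 else 0 := by
  have e₁ : (X b ⟶ X a') ≃ₗ[k] (X a ⊗ X b ⟶ 𝟙_ C) :=
    LinearEquiv.ofBijective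
      { toFun := fun f => X a ◁ f ≫ p.evaluation'
        map_add' := by simp
        map_smul' := by simp } (whiskerLeft_comp_evaluation_bijective p (X b))
  rw [(Linear.homCongr k (Iso.refl (X a ⊗ X b)) (eqToIso ho)).finrank_eq, ← e₁.finrank_eq,
    hX.finrank_hom]
  simp [eq_comm]

end IsSimpleFamily

/-! ### Normalized bases -/

section NormalizedMorphisms

variable {C : Type u} [Category.{v} C] [MonoidalCategory C] {L : Type w} {X : L → C} {o : L} (ho : X o = 𝟙_ C)
  (P : ∀ a, Σ b, ExactPairing (X b) (X a))

/-- The morphisms `X a ⊗ X b ⟶ X c` that a normalized family of bases has to contain: the unit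
isomorphisms and the evaluations. -/
inductive IsNormalized : (Σ p : L × L × L, (X p.1 ⊗ X p.2.1 ⟶ X p.2.2)) → Prop
  | left (a : L) : IsNormalized ⟨(o, a, a), (leftUnitorOfEq ho (X a)).hom⟩
  | right (a : L) : IsNormalized ⟨(a, o, a), (rightUnitorOfEq ho (X a)).hom⟩
  | eval (a : L) : IsNormalized ⟨(a, (P a).1, o), (P a).2.evaluation' ≫ eqToHom ho.symm⟩

variable {ho P}

/-- For given labels there is at most one normalized morphism, provided that the pairing of the
neutral object with itself is given by the unit isomorphism. -/
theorem IsNormalized.eq {p₀ : ExactPairing (X o) (X o)} (hP : P o = ⟨o, p₀⟩)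
    (hp₀ : p₀.evaluation' ≫ eqToHom ho.symm = (leftUnitorOfEq ho (X o)).hom)
    {x y : Σ p : L × L × L, (X p.1 ⊗ X p.2.1 ⟶ X p.2.2)} (hx : IsNormalized ho P x)
    (hy : IsNormalized ho P y) (h : x.1 = y.1) : x = y := by
  have e₁ : (⟨(o, o, o), (leftUnitorOfEq ho (X o)).hom⟩ :
      Σ p : L × L × L, (X p.1 ⊗ X p.2.1 ⟶ X p.2.2)) =
        ⟨(o, o, o), (rightUnitorOfEq ho (X o)).hom⟩ := by
    rw [leftUnitorOfEq_eq_rightUnitorOfEq]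
  have e₂ : (⟨(o, (P o).1, o), (P o).2.evaluation' ≫ eqToHom ho.symm⟩ :
      Σ p : L × L × L, (X p.1 ⊗ X p.2.1 ⟶ X p.2.2)) =
        ⟨(o, o, o), (leftUnitorOfEq ho (X o)).hom⟩ := by
    rw [hP]
    exact congrArg (Sigma.mk _) hp₀
  cases hx <;> cases hy <;> simp only [Prod.mk.injEq] at h
  · obtain ⟨-, rfl, -⟩ := h; rfl
  · obtain ⟨rfl, rfl, -⟩ := h; exact e₁
  · obtain ⟨rfl, -, rfl⟩ := h; exact e₂.symm
  · obtain ⟨rfl, rfl, -⟩ := h; exact e₁.symm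
  · obtain ⟨rfl, -, -⟩ := h; rfl
  · obtain ⟨rfl, -, rfl⟩ := h; exact (e₂.trans e₁).symm
  · obtain ⟨rfl, -, rfl⟩ := h; exact e₂
  · obtain ⟨rfl, -, rfl⟩ := h; exact e₂.trans e₁
  · obtain ⟨rfl, -, -⟩ := h; rfl

variable {k : Type t} [Field k] [Preadditive C] [Linear k C]

theorem IsNormalized.finrank_eq_one [DecidableEq L] [MonoidalPreadditive C] [MonoidalLinear k C]
    (hX : IsSimpleFamily k X) {x : Σ p : L × L × L, (X p.1 ⊗ X p.2.1 ⟶ X p.2.2)}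
    (hx : IsNormalized ho P x) :
    Module.finrank k (X x.1.1 ⊗ X x.1.2.1 ⟶ X x.1.2.2) = 1 := by
  cases hx
  · exact (hX.finrank_unit_left ho _ _).trans (if_pos rfl)
  · exact (hX.finrank_unit_right ho _ _).trans (if_pos rfl)
  · exact (hX.finrank_dual ho (P _).2 _).trans (if_pos rfl)

theorem IsNormalized.ne_zero [MonoidalPreadditive C]
    (hX : IsSimpleFamily k X) {x : Σ p : L × L × L, (X p.1 ⊗ X p.2.1 ⟶ X p.2.2)}
    (hx : IsNormalized ho P x) : x.2 ≠ 0 := by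
  cases hx with
  | left a =>
    intro h
    refine hX.id_ne_zero a ?_
    rw [← (leftUnitorOfEq ho (X a)).inv_hom_id]
    exact (congrArg _ h).trans Limits.comp_zero
  | right a =>
    intro h
    refine hX.id_ne_zero a ?_
    rw [← (rightUnitorOfEq ho (X a)).inv_hom_id]
    exact (congrArg _ h).trans Limits.comp_zero
  | eval a =>
    intro h
    refine evaluation_ne_zero (P a).2 (hX.id_ne_zero a) ?_
    simpa using congrArg (fun g => g ≫ eqToHom ho) h

theorem exists_normalized_basis [DecidableEq L] [MonoidalPreadditive C] [MonoidalLinear k C]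
    [∀ X Y : C, Module.Finite k (X ⟶ Y)] (hX : IsSimpleFamily k X)
    {p₀ : ExactPairing (X o) (X o)} (hP : P o = ⟨o, p₀⟩)
    (hp₀ : p₀.evaluation' ≫ eqToHom ho.symm = (leftUnitorOfEq ho (X o)).hom) (a b c : L) :
    ∃ B : Module.Basis (Fin (Module.finrank k (X a ⊗ X b ⟶ X c))) k (X a ⊗ X b ⟶ X c),
      ∀ x, IsNormalized ho P ⟨(a, b, c), x⟩ → ∀ i, B i = x := by
  by_cases h : ∃ x, IsNormalized ho P ⟨(a, b, c), x⟩
  · obtain ⟨x, hx⟩ := h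
    have h₁ : Module.finrank k (X a ⊗ X b ⟶ X c) = 1 := hx.finrank_eq_one hX
    have : Unique (Fin (Module.finrank k (X a ⊗ X b ⟶ X c))) := by rw [h₁]; infer_instance
    refine ⟨FiniteDimensional.basisSingleton _ h₁ x (hx.ne_zero hX), fun y hy i => ?_⟩
    rw [FiniteDimensional.basisSingleton_apply]
    exact eq_of_heq (Sigma.mk.inj (hx.eq hP hp₀ hy rfl)).2
  · exact ⟨Module.finBasis k _, fun x hx => (h ⟨x, hx⟩).elim⟩

end NormalizedMorphisms

/-- A fusion category admits a choice of representatives, duals and normalized bases. -/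
theorem IsFusionCategory.exists_gauge {k : Type t} [Field k] {C : Type u} [Category.{v} C]
    [Preadditive C] [Linear k C] [MonoidalCategory C] (hC : IsFusionCategory k C) :
    ∃ R : FusionRuleData.{w}, Nonempty (FusionGauge k C R) := by
  classical
  have := hC.monoidalPreadditive
  have := hC.monoidalLinear
  have := hC.finite_hom
  obtain ⟨L, _, X, o, h₁, h₂, h₃, ho⟩ := hC.exists_representatives
  have hX := hC.isSimpleFamily h₁ h₂ h₃
  obtain ⟨p₀, hp₀⟩ := exists_exactPairing_of_eq ho
  -- `η_{1 1}^1` is normalized both as a unit isomorphism and as an evaluation, so the neutral object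
  -- must be its own dual, with the unit isomorphism as the evaluation.
  obtain ⟨P, hP⟩ : ∃ P : ∀ a, Σ b, ExactPairing (X b) (X a), P o = ⟨o, p₀⟩ := by
    choose b hb using hC.exists_exactPairing hX
    refine ⟨fun a => if h : o = a then h ▸ ⟨o, p₀⟩ else ⟨b a, (hb a).some⟩, ?_⟩
    simp
  choose B hB using exists_normalized_basis hX hP hp₀
  exact ⟨{ L := L, one := o, star := fun a => (P a).1
           N := fun a b c => Module.finrank k (X a ⊗ X b ⟶ X c) },
    ⟨{ X := X, simple := h₁, eq_of_iso := h₂, exists_iso := h₃, X_one := ho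
       pairing := fun a => (P a).2
       η := B
       η_left := fun a i => hB _ _ _ _ (.left a) i
       η_right := fun a i => hB _ _ _ _ (.right a) i
       η_eval := fun a i => by
         rw [hB _ _ _ _ (.eval a) i]
         simp }⟩⟩

/-! ### Matrices extracted from a fusion category -/

namespace FusionGauge

variable {k : Type t} [Field k] {C : Type u} [Category.{v} C] [Preadditive C] [Linear k C]
  [MonoidalCategory C] {R : FusionRuleData.{w}} (G : FusionGauge k C R)

theorem N_eq_finrank (a b c : R.L) : R.N a b c = Module.finrank k (G.X a ⊗ G.X b ⟶ G.X c) := by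
  rw [Module.finrank_eq_card_basis (G.η a b c), Fintype.card_fin]

theorem N_one_left (hX : IsSimpleFamily k G.X) (a b : R.L) :
    R.N R.one a b = if a = b then 1 else 0 := by
  rw [G.N_eq_finrank, hX.finrank_unit_left G.X_one]

theorem N_one_right (hX : IsSimpleFamily k G.X) (a b : R.L) :
    R.N a R.one b = if a = b then 1 else 0 := by
  rw [G.N_eq_finrank, hX.finrank_unit_right G.X_one]

section Bases

variable [MonoidalPreadditive C] (hX : IsSimpleFamily k G.X)

include hX

theorem exists_basis_left (a b c u : R.L) :
    ∃ B : Module.Basis (R.Row a b c u) k ((G.X a ⊗ G.X b) ⊗ G.X c ⟶ G.X u),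
      ∀ e i j, B ⟨e, i, j⟩ = (G.η a b e i ▷ G.X c) ≫ G.η e c u j :=
  hX.exists_basis_comp (tensorRight (G.X c)) (G.η a b) (fun e => G.η e c u)

/-- Bases of the spaces of morphisms from `Y` to simple objects give a basis of the spaces of
morphisms from `X a ⊗ Y` to simple objects. -/
theorem exists_basis_tensorLeft (a u : R.L) {Y : C} {J : R.L → Type*} [∀ e, Fintype (J e)]
    (y : ∀ e, Module.Basis (J e) k (Y ⟶ G.X e)) :
    ∃ B : Module.Basis (Σ e, Fin (R.N a e u) × J e) k (G.X a ⊗ Y ⟶ G.X u),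
      ∀ e i j, B ⟨e, i, j⟩ = (G.X a ◁ y e j) ≫ G.η a e u i := by
  obtain ⟨B, hB⟩ := hX.exists_basis_comp (tensorLeft (G.X a)) y (fun e => G.η a e u)
  refine ⟨B.reindex (Equiv.sigmaCongrRight fun e => Equiv.prodComm _ _), fun e i j => ?_⟩
  rw [Module.Basis.reindex_apply]
  exact hB e j i

theorem exists_basis_right (a b c u : R.L) :
    ∃ B : Module.Basis (R.Col a b c u) k (G.X a ⊗ (G.X b ⊗ G.X c) ⟶ G.X u),
      ∀ e i j, B ⟨e, i, j⟩ = (G.X a ◁ G.η b c e j) ≫ G.η a e u i :=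
  G.exists_basis_tensorLeft hX a u (G.η b c)

/-- The basis of `Hom((X a ⊗ X b) ⊗ X c, X u)` that is indexed by rows. -/
def basisLeft (a b c u : R.L) : Module.Basis (R.Row a b c u) k ((G.X a ⊗ G.X b) ⊗ G.X c ⟶ G.X u) :=
  (G.exists_basis_left hX a b c u).choose

theorem basisLeft_apply (a b c u e : R.L) (i : Fin (R.N a b e)) (j : Fin (R.N e c u)) :
    G.basisLeft hX a b c u ⟨e, i, j⟩ = (G.η a b e i ▷ G.X c) ≫ G.η e c u j :=
  (G.exists_basis_left hX a b c u).choose_spec e i j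

/-- The basis of `Hom(X a ⊗ (X b ⊗ X c), X u)` that is indexed by columns. -/
def basisRight (a b c u : R.L) :
    Module.Basis (R.Col a b c u) k (G.X a ⊗ (G.X b ⊗ G.X c) ⟶ G.X u) :=
  (G.exists_basis_right hX a b c u).choose

theorem basisRight_apply (a b c u e : R.L) (i : Fin (R.N a e u)) (j : Fin (R.N b c e)) :
    G.basisRight hX a b c u ⟨e, i, j⟩ = (G.X a ◁ G.η b c e j) ≫ G.η a e u i :=
  (G.exists_basis_right hX a b c u).choose_spec e i j

/-- The basis `basisLeft`, transported along the associator. -/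
def basisAssoc (a b c u : R.L) :
    Module.Basis (R.Row a b c u) k (G.X a ⊗ (G.X b ⊗ G.X c) ⟶ G.X u) :=
  (G.basisLeft hX a b c u).map
    (Linear.homCongr k (α_ (G.X a) (G.X b) (G.X c)) (Iso.refl (G.X u)))

theorem basisAssoc_apply (a b c u e : R.L) (i : Fin (R.N a b e)) (j : Fin (R.N e c u)) :
    G.basisAssoc hX a b c u ⟨e, i, j⟩ =
      (α_ (G.X a) (G.X b) (G.X c)).inv ≫ (G.η a b e i ▷ G.X c) ≫ G.η e c u j := by
  rw [basisAssoc, Module.Basis.map_apply, basisLeft_apply, Linear.homCongr_apply]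
  simp only [Iso.refl_hom, Category.comp_id]

/-- A family of matrices is extracted from the category if and only if it consists of the matrices of
a change of basis. -/
theorem extracts_iff (F : R.FMatrices k) :
    G.Extracts F ↔ ∀ a b c u r s,
      F a b c u r s = (G.basisRight hX a b c u).repr (G.basisAssoc hX a b c u r) s := by
  have h : ∀ a b c u r, G.basisAssoc hX a b c u r = ∑ s, F a b c u r s • G.basisRight hX a b c u s ↔
      ∀ s, F a b c u r s = (G.basisRight hX a b c u).repr (G.basisAssoc hX a b c u r) s := by
    intro a b c u r
    constructor
    · intro h s
      rw [h, Module.Basis.repr_sum_self]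
    · intro h
      simp only [h, Module.Basis.sum_repr]
  simp only [← h]
  constructor
  · rintro H a b c u ⟨e, i, j⟩
    rw [basisAssoc_apply, H]
    simp only [Fintype.sum_sigma, Fintype.sum_prod_type, basisRight_apply]
  · intro H a b c u e i j
    rw [← G.basisAssoc_apply hX, H]
    simp only [Fintype.sum_sigma, Fintype.sum_prod_type, basisRight_apply]

theorem existsUnique_extracts : ∃! F : R.FMatrices k, G.Extracts F := by
  refine ⟨fun a b c u => Matrix.of fun r s =>
    (G.basisRight hX a b c u).repr (G.basisAssoc hX a b c u r) s,
    (G.extracts_iff hX _).2 fun _ _ _ _ _ _ => rfl, fun F hF => ?_⟩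
  funext a b c u
  ext r s
  exact (G.extracts_iff hX F).1 hF a b c u r s

theorem invertible_of_extracts {F : R.FMatrices k} (hF : G.Extracts F) (a b c u : R.L) :
    ∃ M : Matrix (R.Col a b c u) (R.Row a b c u) k, F a b c u * M = 1 ∧ M * F a b c u = 1 := by
  have h : F a b c u = ((G.basisRight hX a b c u).toMatrix (G.basisAssoc hX a b c u)).transpose := by
    ext r s
    exact (G.extracts_iff hX F).1 hF a b c u r s
  refine ⟨((G.basisAssoc hX a b c u).toMatrix (G.basisRight hX a b c u)).transpose, ?_, ?_⟩
  · rw [h, ← Matrix.transpose_mul, Module.Basis.toMatrix_mul_toMatrix_flip, Matrix.transpose_one]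
  · rw [h, ← Matrix.transpose_mul, Module.Basis.toMatrix_mul_toMatrix_flip, Matrix.transpose_one]

theorem N_assoc (a b c u : R.L) :
    ∑ e, R.N a b e * R.N e c u = ∑ e, R.N a e u * R.N b c e := by
  have := Fintype.card_congr
    ((G.basisAssoc hX a b c u).indexEquiv (G.basisRight hX a b c u))
  simpa using this

theorem triangle_of_extracts {F : R.FMatrices k} (hF : G.Extracts F) (a b u : R.L)
    (i : Fin (R.N a R.one a)) (j i' : Fin (R.N a b u)) (j' : Fin (R.N R.one b b))
    [Subsingleton (Fin (R.N R.one b b))] :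
    F.entry i j i' j' = if j = i' then 1 else 0 := by
  have h : G.basisAssoc hX a R.one b u ⟨a, i, j⟩ = G.basisRight hX a R.one b u ⟨b, j, j'⟩ := by
    rw [basisAssoc_apply, basisRight_apply, G.η_left, G.η_right, comp_whiskerRight, Category.assoc,
      whiskerLeft_comp, Category.assoc, ← associator_inv_naturality_middle_assoc,
      triangle_assoc_comp_right_assoc]
  rw [FusionRuleData.FMatrices.entry, (G.extracts_iff hX F).1 hF, h, Module.Basis.repr_self,
    Finsupp.single_apply]
  simp

theorem duality_of_extracts {F : R.FMatrices k} (hF : G.Extracts F) (a : R.L)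
    (i : Fin (R.N a (R.star a) R.one)) (j : Fin (R.N R.one a a)) (i' : Fin (R.N a R.one a))
    (j' : Fin (R.N (R.star a) a R.one)) [Subsingleton (Fin (R.N a R.one a))]
    [Subsingleton (Fin (R.N (R.star a) a R.one))] : F.entry i j i' j' ≠ 0 := by
  intro h₀
  have h := hX.zigzag_eq G.X_one (fun a b c => G.η a b c) F i j i' j' (hF _ _ _ _ _ i j)
    (G.pairing a).coevaluation'
  rw [h₀, zero_smul, G.η_left, ← comp_whiskerRight_assoc, G.η_eval] at h
  have h₂ := (G.pairing a).coevaluation_evaluation'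
  rw [Iso.eq_comp_inv, Category.assoc, Category.assoc, h] at h₂
  have h₃ := (ρ_ (G.X a)).inv_hom_id
  rw [← h₂, Limits.comp_zero] at h₃
  exact hX.id_ne_zero a h₃.symm

variable [MonoidalLinear k C]

theorem N_dual (a b : R.L) : R.N a b R.one = if R.star a = b then 1 else 0 := by
  rw [G.N_eq_finrank, hX.finrank_dual G.X_one (G.pairing a)]

theorem star_one : R.star R.one = R.one := by
  have h₁ := G.N_one_left hX R.one R.one
  rw [G.N_dual hX, if_pos rfl] at h₁
  by_contra h
  simp [h] at h₁

/-- By semisimplicity the coevaluation `1 ⟶ a* ⊗ a` gives a non-zero morphism `a* ⊗ a ⟶ 1`. -/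
theorem star_star (a : R.L) : R.star (R.star a) = a := by
  -- If the coevaluation were zero, then the zigzag identity would make `X a` zero.
  have h₀ : eqToHom G.X_one ≫ (G.pairing a).coevaluation' ≠ 0 := by
    intro h
    have h₁ : (G.pairing a).coevaluation' = 0 := by
      simpa using congrArg (fun g => eqToHom G.X_one.symm ≫ g) h
    have h₂ := (G.pairing a).coevaluation_evaluation'
    rw [h₁, MonoidalPreadditive.whiskerLeft_zero, Limits.zero_comp, Iso.eq_comp_inv,
      Limits.zero_comp] at h₂
    have h₃ := (ρ_ (G.X a)).inv_hom_id
    rw [← h₂, Limits.comp_zero] at h₃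
    exact hX.id_ne_zero a h₃.symm
  obtain ⟨g, hg⟩ := hX.exists_ne_zero_of_ne_zero h₀
  by_contra h
  -- Otherwise `N_{a* a}^1 = 0`, so that there is no non-zero morphism `a* ⊗ a ⟶ 1`.
  have h₁ := G.N_dual hX (R.star a) a
  rw [if_neg h] at h₁
  refine hg ((G.η (R.star a) a R.one).ext_elem fun i => ?_)
  exact absurd (i.2.trans_eq h₁) (Nat.not_lt_zero _)

end Bases

end FusionGauge

/-! ### The pentagon equation -/

namespace FusionGauge

variable {k : Type t} [Field k] {C : Type u} [Category.{v} C] [Preadditive C] [Linear k C]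
  [MonoidalCategory C] {R : FusionRuleData.{w}} (G : FusionGauge k C R)

/-- The composites `X a ⊗ (X b ⊗ (X c ⊗ X d)) ⟶ X u` in terms of which both sides of the pentagon
are expanded. -/
def pentagonBasis (a b c d u h : R.L) (n : Fin (R.N a h u)) (g : R.L) (o : Fin (R.N b g h))
    (m : Fin (R.N c d g)) : G.X a ⊗ (G.X b ⊗ (G.X c ⊗ G.X d)) ⟶ G.X u :=
  G.X a ◁ (G.X b ◁ G.η c d g m ≫ G.η b g h o) ≫ G.η a h u n

theorem pentagonBasis_injective [MonoidalPreadditive C] (hX : IsSimpleFamily k G.X) (a b c d u : R.L)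
    {x y : ∀ h, Fin (R.N a h u) → ∀ g, Fin (R.N b g h) → Fin (R.N c d g) → k}
    (H : ∑ h, ∑ n, ∑ g, ∑ o, ∑ m, x h n g o m • G.pentagonBasis a b c d u h n g o m =
      ∑ h, ∑ n, ∑ g, ∑ o, ∑ m, y h n g o m • G.pentagonBasis a b c d u h n g o m)
    (h n g o m) : x h n g o m = y h n g o m := by
  obtain ⟨B, hB⟩ := G.exists_basis_tensorLeft hX a u (fun e => G.basisRight hX b c d e)
  have hB' : ∀ h n g o m, B ⟨h, n, ⟨g, o, m⟩⟩ = G.pentagonBasis a b c d u h n g o m := by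
    intro h n g o m
    rw [hB, basisRight_apply]
    rfl
  have key : ∀ z : ∀ h, Fin (R.N a h u) → ∀ g, Fin (R.N b g h) → Fin (R.N c d g) → k,
      ∑ h, ∑ n, ∑ g, ∑ o, ∑ m, z h n g o m • G.pentagonBasis a b c d u h n g o m =
        ∑ s : (Σ h, Fin (R.N a h u) × R.Col b c d h),
          z s.1 s.2.1 s.2.2.1 s.2.2.2.1 s.2.2.2.2 • B s := by
    intro z
    simp only [Fintype.sum_sigma, Fintype.sum_prod_type, hB']
  rw [key x, key y] at H
  have h₁ := congrArg (fun f => B.repr f ⟨h, n, ⟨g, o, m⟩⟩) H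
  simpa only [Module.Basis.repr_sum_self] using h₁

variable {G} {F : R.FMatrices k} (hF : G.Extracts F)

include hF

/-- The side of the pentagon with two associativity isomorphisms, expanded in `pentagonBasis`. -/
theorem pentagon_six (a b c d u e f : R.L) (i : Fin (R.N a b e)) (j : Fin (R.N e c f))
    (l : Fin (R.N f d u)) :
    (α_ (G.X a) (G.X b) (G.X c ⊗ G.X d)).inv ≫ (α_ (G.X a ⊗ G.X b) (G.X c) (G.X d)).inv ≫
      (G.η a b e i ▷ G.X c ▷ G.X d) ≫ (G.η e c f j ▷ G.X d) ≫ G.η f d u l =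
    ∑ g, ∑ x : Fin (R.N e g u), ∑ m : Fin (R.N c d g), ∑ h, ∑ n : Fin (R.N a h u),
      ∑ o : Fin (R.N b g h), (F.entry j l x m * F.entry i x n o) •
        G.pentagonBasis a b c d u h n g o m := by
  have step : ∀ (g : R.L) (x : Fin (R.N e g u)) (m : Fin (R.N c d g)),
      (α_ (G.X a) (G.X b) (G.X c ⊗ G.X d)).inv ≫ (G.η a b e i ▷ (G.X c ⊗ G.X d)) ≫
        (G.X e ◁ G.η c d g m) ≫ G.η e g u x =
      ∑ h, ∑ n : Fin (R.N a h u), ∑ o : Fin (R.N b g h), F.entry i x n o •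
        G.pentagonBasis a b c d u h n g o m := by
    intro g x m
    rw [← whisker_exchange_assoc, ← associator_inv_naturality_right_assoc, hF]
    simp only [Preadditive.comp_sum, Linear.comp_smul, pentagonBasis, whiskerLeft_comp,
      Category.assoc]
  rw [← associator_inv_naturality_left_assoc, hF]
  simp only [Preadditive.comp_sum, Linear.comp_smul, step, Finset.smul_sum, smul_smul]

variable [MonoidalPreadditive C] [MonoidalLinear k C]

/-- The side of the pentagon with three associativity isomorphisms, expanded in `pentagonBasis`. -/
theorem pentagon_nine (a b c d u e f : R.L) (i : Fin (R.N a b e)) (j : Fin (R.N e c f))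
    (l : Fin (R.N f d u)) :
    (G.X a ◁ (α_ (G.X b) (G.X c) (G.X d)).inv) ≫ (α_ (G.X a) (G.X b ⊗ G.X c) (G.X d)).inv ≫
      ((α_ (G.X a) (G.X b) (G.X c)).inv ▷ G.X d) ≫
      (G.η a b e i ▷ G.X c ▷ G.X d) ≫ (G.η e c f j ▷ G.X d) ≫ G.η f d u l =
    ∑ q, ∑ p : Fin (R.N a q f), ∑ r : Fin (R.N b c q), ∑ h, ∑ n : Fin (R.N a h u),
      ∑ z : Fin (R.N q d h), ∑ g, ∑ o : Fin (R.N b g h), ∑ m : Fin (R.N c d g),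
        (F.entry i j p r * F.entry p l n z * F.entry r z o m) •
        G.pentagonBasis a b c d u h n g o m := by
  have step₁ : ∀ (q : R.L) (r : Fin (R.N b c q)) (h : R.L) (n : Fin (R.N a h u))
      (z : Fin (R.N q d h)),
      (G.X a ◁ (α_ (G.X b) (G.X c) (G.X d)).inv) ≫ (G.X a ◁ (G.η b c q r ▷ G.X d)) ≫
        (G.X a ◁ G.η q d h z) ≫ G.η a h u n =
      ∑ g, ∑ o : Fin (R.N b g h), ∑ m : Fin (R.N c d g), F.entry r z o m •
        G.pentagonBasis a b c d u h n g o m := by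
    intro q r h n z
    rw [← whiskerLeft_comp_assoc, ← whiskerLeft_comp_assoc, Category.assoc, hF]
    simp only [whiskerLeft_sum, MonoidalLinear.whiskerLeft_smul, Preadditive.sum_comp,
      Linear.smul_comp, pentagonBasis]
  have step₂ : ∀ (q : R.L) (p : Fin (R.N a q f)) (r : Fin (R.N b c q)),
      (G.X a ◁ (α_ (G.X b) (G.X c) (G.X d)).inv) ≫ (α_ (G.X a) (G.X b ⊗ G.X c) (G.X d)).inv ≫
        ((G.X a ◁ G.η b c q r) ▷ G.X d) ≫ (G.η a q f p ▷ G.X d) ≫ G.η f d u l =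
      ∑ h, ∑ n : Fin (R.N a h u), ∑ z : Fin (R.N q d h), ∑ g, ∑ o : Fin (R.N b g h),
        ∑ m : Fin (R.N c d g), (F.entry p l n z * F.entry r z o m) •
          G.pentagonBasis a b c d u h n g o m := by
    intro q p r
    rw [← associator_inv_naturality_middle_assoc, hF]
    simp only [Preadditive.comp_sum, Linear.comp_smul, step₁, Finset.smul_sum, smul_smul]
  have h : ((α_ (G.X a) (G.X b) (G.X c)).inv ▷ G.X d) ≫ (G.η a b e i ▷ G.X c ▷ G.X d) ≫
      (G.η e c f j ▷ G.X d) = ∑ q, ∑ p : Fin (R.N a q f), ∑ r : Fin (R.N b c q),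
        F.entry i j p r • (((G.X a ◁ G.η b c q r) ▷ G.X d) ≫ (G.η a q f p ▷ G.X d)) := by
    rw [← comp_whiskerRight, ← comp_whiskerRight, hF]
    simp only [sum_whiskerRight, MonoidalLinear.smul_whiskerRight, comp_whiskerRight]
  rw [reassoc_of% h]
  simp only [Preadditive.sum_comp, Preadditive.comp_sum, Linear.smul_comp, Linear.comp_smul,
    Category.assoc, step₂, Finset.smul_sum, smul_smul, mul_assoc]

theorem pentagon_of_extracts (hX : IsSimpleFamily k G.X) (a b c d u e f g h : R.L)
    (i : Fin (R.N a b e)) (j : Fin (R.N e c f)) (l : Fin (R.N f d u)) (n : Fin (R.N a h u))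
    (o : Fin (R.N b g h)) (m : Fin (R.N c d g)) :
    ∑ x : Fin (R.N e g u), F.entry j l x m * F.entry i x n o =
      ∑ q : R.L, ∑ p : Fin (R.N a q f), ∑ r : Fin (R.N b c q), ∑ z : Fin (R.N q d h),
        F.entry i j p r * F.entry p l n z * F.entry r z o m := by
  refine G.pentagonBasis_injective hX a b c d u
    (x := fun h n g o m => ∑ x : Fin (R.N e g u), F.entry j l x m * F.entry i x n o)
    (y := fun h n g o m => ∑ q : R.L, ∑ p : Fin (R.N a q f), ∑ r : Fin (R.N b c q),
      ∑ z : Fin (R.N q d h), F.entry i j p r * F.entry p l n z * F.entry r z o m) ?_ h n g o m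
  simp only [Finset.sum_smul]
  refine ((sum_reorder_six _).symm.trans ?_).trans (sum_reorder_nine _)
  rw [← pentagon_six hF, ← pentagon_nine hF, pentagon_inv_assoc]

theorem isFusionSystem_of_extracts (hX : IsSimpleFamily k G.X) : R.IsFusionSystem F where
  star_star := G.star_star hX
  star_one := G.star_one hX
  N_one_left := G.N_one_left hX
  N_one_right := G.N_one_right hX
  N_dual := G.N_dual hX
  N_assoc := G.N_assoc hX
  invertible := G.invertible_of_extracts hX hF
  triangle a b u i j i' j' := by
    have : Subsingleton (Fin (R.N R.one b b)) := by
      rw [G.N_one_left hX, if_pos rfl]; infer_instance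
    exact G.triangle_of_extracts hX hF a b u i j i' j'
  duality a i j i' j' := by
    have : Subsingleton (Fin (R.N a R.one a)) := by
      rw [G.N_one_right hX, if_pos rfl]; infer_instance
    have : Subsingleton (Fin (R.N (R.star a) a R.one)) := by
      rw [G.N_dual hX, if_pos (G.star_star hX a)]; infer_instance
    exact G.duality_of_extracts hX hF a i j i' j'
  pentagon := pentagon_of_extracts hF hX

end FusionGauge

/-! ### The functor from `C(L, N, F)` to `C` -/

namespace FusionGauge

open FusionSystem

variable {k : Type t} [Field k] {C : Type u} [Category.{v} C] [Preadditive C] [Linear k C]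
  [MonoidalCategory C] {S : FusionSystem.{t, w} k} {G : FusionGauge k C S.R}
  [Limits.HasFiniteBiproducts C]

variable (G) in
/-- The object `⊕_a f(a) X a` of `C`. -/
def realizeObj (f : S.Obj) : C := ⨁ fun p : (Σ a : S.L, Fin (f a)) => G.X p.1

variable (G) in
/-- The projection of `⊕_a f(a) X a` to a summand. -/
def realizeπ (f : S.Obj) (a : S.L) (m : Fin (f a)) : G.realizeObj f ⟶ G.X a :=
  Limits.biproduct.π (fun p : (Σ a : S.L, Fin (f a)) => G.X p.1) ⟨a, m⟩

variable (G) in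
/-- The inclusion of a summand of `⊕_a f(a) X a`. -/
def realizeι (f : S.Obj) (a : S.L) (m : Fin (f a)) : G.X a ⟶ G.realizeObj f :=
  Limits.biproduct.ι (fun p : (Σ a : S.L, Fin (f a)) => G.X p.1) ⟨a, m⟩

theorem realizeι_π (f : S.Obj) (a : S.L) (m m' : Fin (f a)) :
    G.realizeι f a m ≫ G.realizeπ f a m' = if m = m' then 𝟙 _ else 0 := by
  split_ifs with h
  · subst h; exact Limits.biproduct.ι_π_self _ _
  · exact Limits.biproduct.ι_π_ne _ fun h' => h (eq_of_heq (Sigma.mk.inj h').2)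

theorem realize_total (f : S.Obj) :
    ∑ a, ∑ m, G.realizeπ f a m ≫ G.realizeι f a m = 𝟙 (G.realizeObj f) := by
  refine Limits.biproduct.hom_ext _ _ fun ⟨b, n⟩ => ?_
  change _ ≫ G.realizeπ f b n = 𝟙 _ ≫ G.realizeπ f b n
  rw [Category.id_comp, Preadditive.sum_comp, Finset.sum_eq_single b, Preadditive.sum_comp,
    Finset.sum_eq_single n]
  · rw [Category.assoc, realizeι_π, if_pos rfl, Category.comp_id]
  · intro m _ h
    rw [Category.assoc, realizeι_π, if_neg h, Limits.comp_zero]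
  · simp
  · intro a _ h
    rw [Preadditive.sum_comp]
    refine Finset.sum_eq_zero fun m _ => ?_
    have h₀ : G.realizeι f a m ≫ G.realizeπ f b n = 0 :=
      Limits.biproduct.ι_π_ne _ fun h' => h (Sigma.mk.inj h').1
    rw [Category.assoc, h₀, Limits.comp_zero]
  · simp

variable (hX : IsSimpleFamily k G.X)

include hX

theorem exists_realizeBasis (f : S.Obj) (a : S.L) :
    ∃ B : Module.Basis (Fin (f a)) k (G.realizeObj f ⟶ G.X a), ∀ m, B m = G.realizeπ f a m := by
  have li : LinearIndependent k (G.realizeπ f a) := by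
    refine Fintype.linearIndependent_iff.2 fun c hc m => ?_
    have h := congrArg (fun g => G.realizeι f a m ≫ g) hc
    simp only [Preadditive.comp_sum, Linear.comp_smul, realizeι_π, Limits.comp_zero] at h
    rw [Finset.sum_eq_single m (fun m' _ hm => by rw [if_neg hm.symm, smul_zero]) (by simp),
      if_pos rfl] at h
    exact (smul_eq_zero.1 h).resolve_right (hX.id_ne_zero a)
  refine ⟨Module.Basis.mk li ?_, fun m => Module.Basis.mk_apply _ _ _⟩
  rintro g -
  rw [← Category.id_comp g, ← realize_total f]
  simp only [Preadditive.sum_comp, Category.assoc]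
  refine Submodule.sum_mem _ fun b _ => Submodule.sum_mem _ fun m _ => ?_
  by_cases hb : b = a
  · subst hb
    obtain ⟨r, hr⟩ := hX.end_eq_smul b (G.realizeι f b m ≫ g)
    rw [hr, Linear.comp_smul, Category.comp_id]
    exact Submodule.smul_mem _ _ (Submodule.subset_span ⟨m, rfl⟩)
  · rw [hX.hom_eq_zero hb (G.realizeι f b m ≫ g), Limits.comp_zero]
    exact Submodule.zero_mem _

/-- The projections form a basis of the space of morphisms to a simple object. -/
def realizeBasis (f : S.Obj) (a : S.L) : Module.Basis (Fin (f a)) k (G.realizeObj f ⟶ G.X a) :=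
  (exists_realizeBasis hX f a).choose

theorem realizeBasis_apply (f : S.Obj) (a : S.L) (m : Fin (f a)) :
    realizeBasis hX f a m = G.realizeπ f a m := (exists_realizeBasis hX f a).choose_spec m

/-- Covectors of `f a` are the morphisms from `⊕_a f(a) X a` to `X a`. -/
def cov (f : S.Obj) (a : S.L) : Cov f a ≃ₗ[k] (G.realizeObj f ⟶ G.X a) :=
  (realizeBasis hX f a).equivFun.symm

theorem cov_single (f : S.Obj) (a : S.L) (m : Fin (f a)) :
    cov hX f a (Pi.single m 1) = G.realizeπ f a m := by
  rw [← realizeBasis_apply hX, cov, LinearEquiv.symm_apply_eq]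
  ext n
  rw [Module.Basis.equivFun_self, Pi.single_apply]
  simp only [eq_comm]

theorem cov_hom_ext {Y : C} {f : S.Obj} {h h' : Y ⟶ G.realizeObj f}
    (H : ∀ a v, h ≫ cov hX f a v = h' ≫ cov hX f a v) : h = h' :=
  hX.hom_ext fun a g => by
    obtain ⟨v, rfl⟩ := (cov hX f a).surjective g
    exact H a v

theorem cov_tens_hom_ext {Y : C} {f g : S.Obj} {h h' : Y ⟶ G.realizeObj (tensObj f g)}
    (H : ∀ a b c (i : Fin (S.N a b c)) (v : Cov f a) (w : Cov g b),
      h ≫ cov hX _ c (tens a b c i v w) = h' ≫ cov hX _ c (tens a b c i v w)) : h = h' :=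
  cov_hom_ext hX fun c x => by
    refine LinearMap.congr_fun (f := Linear.leftComp k (G.X c) h ∘ₗ (cov hX _ c).toLinearMap)
      (g := Linear.leftComp k (G.X c) h' ∘ₗ (cov hX _ c).toLinearMap) (tens_ext fun a b i v w => ?_) x
    exact H a b c i v w

theorem cov_tens_hom_ext₃ {Y : C} {f g l : S.Obj}
    {h h' : Y ⟶ G.realizeObj (tensObj (tensObj f g) l)}
    (H : ∀ a b c e u (i : Fin (S.N a b e)) (j : Fin (S.N e c u)) (v : Cov f a) (w : Cov g b)
      (z : Cov l c), h ≫ cov hX _ u (tens e c u j (tens a b e i v w) z) =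
        h' ≫ cov hX _ u (tens e c u j (tens a b e i v w) z)) : h = h' :=
  cov_hom_ext hX fun u x => by
    refine LinearMap.congr_fun (f := Linear.leftComp k (G.X u) h ∘ₗ (cov hX _ u).toLinearMap)
      (g := Linear.leftComp k (G.X u) h' ∘ₗ (cov hX _ u).toLinearMap)
      (tens_ext₃ fun a b c e i j v w z => ?_) x
    exact H a b c e u i j v w z

/-- The morphism `⊕_a f(a) X a ⟶ ⊕_a g(a) X a` which is given by a family of matrices. -/
def realizeMap {f g : S.Obj} (A : f ⟶ g) : G.realizeObj f ⟶ G.realizeObj g :=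
  hX.homOf fun a => (cov hX f a).toLinearMap ∘ₗ act A a ∘ₗ (cov hX g a).symm.toLinearMap

theorem realizeMap_cov {f g : S.Obj} (A : f ⟶ g) (a : S.L) (v : Cov g a) :
    realizeMap hX A ≫ cov hX g a v = cov hX f a (act A a v) := by
  simp [realizeMap, hX.homOf_comp]

theorem realizeMap_id (f : S.Obj) : realizeMap hX (𝟙 f) = 𝟙 (G.realizeObj f) :=
  cov_hom_ext hX fun a v => by simp [realizeMap_cov]

theorem realizeMap_comp {f g h : S.Obj} (A : f ⟶ g) (B : g ⟶ h) :
    realizeMap hX (A ≫ B) = realizeMap hX A ≫ realizeMap hX B :=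
  cov_hom_ext hX fun a v => by simp [realizeMap_cov]

theorem realizeMap_add {f g : S.Obj} (A B : f ⟶ g) :
    realizeMap hX (A + B) = realizeMap hX A + realizeMap hX B :=
  cov_hom_ext hX fun a v => by simp [realizeMap_cov, act_add]

theorem realizeMap_smul {f g : S.Obj} (A : f ⟶ g) (r : k) :
    realizeMap hX (r • A) = r • realizeMap hX A :=
  cov_hom_ext hX fun a v => by simp [realizeMap_cov, act_smul]

theorem realizeMap_injective {f g : S.Obj} {A B : f ⟶ g} (h : realizeMap hX A = realizeMap hX B) :
    A = B :=
  FusionSystem.hom_ext fun a => LinearMap.ext fun v => by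
    refine (cov hX f a).injective ?_
    rw [← realizeMap_cov, ← realizeMap_cov, h]

theorem realizeMap_surjective {f g : S.Obj} (h : G.realizeObj f ⟶ G.realizeObj g) :
    ∃ A : f ⟶ g, realizeMap hX A = h := by
  refine ⟨ofAct fun a => (cov hX f a).symm.toLinearMap ∘ₗ Linear.leftComp k (G.X a) h ∘ₗ
    (cov hX g a).toLinearMap, cov_hom_ext hX fun a v => ?_⟩
  rw [realizeMap_cov, act_ofAct]
  exact (cov hX f a).apply_symm_apply _

theorem exists_iso_realizeObj [∀ X Y : C, Module.Finite k (X ⟶ Y)] (Y : C) :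
    ∃ f : S.Obj, Nonempty (G.realizeObj f ≅ Y) := by
  let f : S.Obj := ⟨fun a => Module.finrank k (Y ⟶ G.X a)⟩
  let e : ∀ a, Cov f a ≃ₗ[k] (Y ⟶ G.X a) := fun a => (Module.finBasis k _).equivFun.symm
  let h : Y ⟶ G.realizeObj f := hX.homOf fun a => ((cov hX f a).symm.trans (e a)).toLinearMap
  have : IsIso h := hX.isIso_of_bijective h fun a => by
    rw [funext fun g => hX.homOf_comp _ g]
    exact ((cov hX f a).symm.trans (e a)).bijective
  exact ⟨f, ⟨(asIso h).symm⟩⟩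

/-- The functor from `C(L, N, F)` to `C` which maps `f` to `⊕_a f(a) X a`. -/
def realize : S.Obj ⥤ C where
  obj := G.realizeObj
  map := realizeMap hX
  map_id := realizeMap_id hX
  map_comp := realizeMap_comp hX

theorem realize_additive : (realize hX).Additive where
  map_add := realizeMap_add hX _ _

theorem realize_linear : (realize hX).Linear k where
  map_smul := realizeMap_smul hX

theorem realize_isEquivalence [∀ X Y : C, Module.Finite k (X ⟶ Y)] :
    (realize hX).IsEquivalence where
  faithful := ⟨realizeMap_injective hX⟩
  full := ⟨realizeMap_surjective hX⟩
  essSurj := ⟨exists_iso_realizeObj hX⟩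

variable [MonoidalPreadditive C]

/-- The composites of tensor products of projections with the morphisms `η_{ab}^{c,i}` form a basis
of the space of morphisms from the tensor product to a simple object. -/
theorem exists_tensBasis (f g : S.Obj) (c : S.L) :
    ∃ B : Module.Basis (Fin (tensObj f g c)) k (G.realizeObj f ⊗ G.realizeObj g ⟶ G.X c),
      ∀ a b m n i, B ((idx f g c).symm ⟨(a, b), m, n, i⟩) =
        (G.realizeπ f a m ⊗ₘ G.realizeπ g b n) ≫ G.η a b c i := by
  choose B₁ h₁ using fun a => G.exists_basis_tensorLeft hX a c (realizeBasis hX g)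
  obtain ⟨B₂, h₂⟩ := hX.exists_basis_comp (tensorRight (G.realizeObj g)) (realizeBasis hX f) B₁
  let e : (Σ a : S.L, Fin (f a) × Σ b : S.L, Fin (S.N a b c) × Fin (g b)) ≃ TIdx f g c :=
    { toFun := fun x => ⟨(x.1, x.2.2.1), x.2.1, x.2.2.2.2, x.2.2.2.1⟩
      invFun := fun y => ⟨y.1.1, y.2.1, ⟨y.1.2, y.2.2.2, y.2.2.1⟩⟩
      left_inv := fun _ => rfl
      right_inv := fun _ => rfl }
  refine ⟨B₂.reindex (e.trans (idx f g c).symm), fun a b m n i => ?_⟩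
  rw [Module.Basis.reindex_apply, Equiv.symm_trans_apply, Equiv.symm_symm, Equiv.apply_symm_apply]
  refine (h₂ a m ⟨b, i, n⟩).trans ?_
  rw [h₁, realizeBasis_apply, realizeBasis_apply, MonoidalCategory.tensorHom_def, Category.assoc]
  rfl

/-- The isomorphism `(⊕_a f(a) X a) ⊗ (⊕_b g(b) X b) ⟶ ⊕_c (f ⊗ g)(c) X c` that is given by the
morphisms `η_{ab}^{c,i}`. -/
def realizeμ (f g : S.Obj) :
    G.realizeObj f ⊗ G.realizeObj g ⟶ G.realizeObj (tensObj f g) :=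
  hX.homOf fun c => ((cov hX (tensObj f g) c).symm.trans
    (exists_tensBasis hX f g c).choose.equivFun.symm).toLinearMap

theorem realizeμ_isIso (f g : S.Obj) : IsIso (realizeμ hX f g) :=
  hX.isIso_of_bijective _ fun c => by
    rw [realizeμ, funext fun g => hX.homOf_comp _ g]
    exact ((cov hX (tensObj f g) c).symm.trans
      (exists_tensBasis hX f g c).choose.equivFun.symm).bijective

theorem realizeμ_cov [MonoidalLinear k C] (f g : S.Obj) {a b c : S.L} (i : Fin (S.N a b c))
    (v : Cov f a) (w : Cov g b) :
    realizeμ hX f g ≫ cov hX _ c (tens a b c i v w) =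
      (cov hX f a v ⊗ₘ cov hX g b w) ≫ G.η a b c i := by
  let Ψ : (G.realizeObj f ⟶ G.X a) →ₗ[k] (G.realizeObj g ⟶ G.X b) →ₗ[k]
      (G.realizeObj f ⊗ G.realizeObj g ⟶ G.X c) :=
    LinearMap.mk₂ k (fun p q => (p ⊗ₘ q) ≫ G.η a b c i)
      (fun _ _ _ => by simp [MonoidalPreadditive.add_tensor])
      (fun _ _ _ => by simp [MonoidalCategory.tensorHom_def])
      (fun _ _ _ => by simp [MonoidalPreadditive.tensor_add])
      (fun _ _ _ => by simp [MonoidalCategory.tensorHom_def])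
  -- Both sides are bilinear in `v` and `w`, so it suffices to compare them on basis covectors.
  have key : (tens a b c i).compr₂ (Linear.leftComp k (G.X c) (realizeμ hX f g) ∘ₗ
      (cov hX (tensObj f g) c).toLinearMap) =
      Ψ.compl₁₂ (cov hX f a).toLinearMap (cov hX g b).toLinearMap := by
    refine cov_ext₂ fun m n => ?_
    have h₁ : realizeμ hX f g ≫ cov hX _ c (lab ⟨(a, b), m, n, i⟩) =
        (G.realizeπ f a m ⊗ₘ G.realizeπ g b n) ≫ G.η a b c i := by
      rw [← (exists_tensBasis hX f g c).choose_spec a b m n i, realizeμ, hX.homOf_comp]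
      simp only [LinearEquiv.coe_coe, LinearEquiv.trans_apply, LinearEquiv.symm_apply_apply]
      rw [LinearEquiv.symm_apply_eq]
      ext x
      rw [Module.Basis.equivFun_self, lab, Pi.single_apply]
      simp only [eq_comm]
    simp only [LinearMap.compr₂_apply, LinearMap.compl₁₂_apply, LinearMap.comp_apply, tens_single,
      LinearEquiv.coe_coe, Linear.leftComp_apply, h₁, cov_single]
    rfl
  exact congrArg (fun φ => φ v w) key

end FusionGauge

/-! ### The monoidal structure of the functor -/

namespace FusionGauge

open FusionSystem

variable {k : Type t} [Field k] {C : Type u} [Category.{v} C] [Preadditive C] [Linear k C]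
  [MonoidalCategory C] {S : FusionSystem.{t, w} k} {G : FusionGauge k C S.R}
  [Limits.HasFiniteBiproducts C]

variable (G) in
/-- The isomorphism between the neutral object and the image of the neutral object. -/
def realizeε : 𝟙_ C ≅ G.realizeObj (unitObj : S.Obj) where
  hom := eqToHom G.X_one.symm ≫ G.realizeι unitObj S.R.one ⟨0, by rw [unitObj_one]; exact one_pos⟩
  inv := G.realizeπ unitObj S.R.one ⟨0, by rw [unitObj_one]; exact one_pos⟩ ≫ eqToHom G.X_one
  hom_inv_id := by
    rw [Category.assoc, ← Category.assoc (G.realizeι _ _ _), realizeι_π, if_pos rfl,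
      Category.id_comp, eqToHom_trans, eqToHom_refl]
  inv_hom_id := by
    have : Subsingleton (Fin ((unitObj : S.Obj) S.R.one)) := by
      rw [unitObj_one]; infer_instance
    rw [Category.assoc, eqToHom_trans_assoc, eqToHom_refl, Category.id_comp, ← realize_total,
      Finset.sum_eq_single S.R.one, Fintype.sum_subsingleton]
    · intro a _ ha
      have : IsEmpty (Fin ((unitObj : S.Obj) a)) := by
        rw [unitObj_ne ha.symm]; infer_instance
      exact Finset.sum_of_isEmpty _
    · simp

variable (hX : IsSimpleFamily k G.X)

include hX

theorem realizeε_cov :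
    G.realizeε.hom ≫ cov hX (unitObj : S.Obj) S.R.one unitCov = eqToHom G.X_one.symm := by
  rw [unitCov_eq_single ⟨0, by rw [unitObj_one]; exact one_pos⟩, cov_single, realizeε,
    Category.assoc, realizeι_π, if_pos rfl, Category.comp_id]

variable [MonoidalPreadditive C] [MonoidalLinear k C]

theorem realizeμ_natural {f f' g g' : S.Obj} (A : f ⟶ f') (B : g ⟶ g') :
    (realizeMap hX A ⊗ₘ realizeMap hX B) ≫ realizeμ hX f' g' =
      realizeμ hX f g ≫ realizeMap hX (tensHom A B) :=
  cov_tens_hom_ext hX fun a b c i v w => by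
    rw [Category.assoc, Category.assoc, realizeμ_cov, realizeMap_cov, act_tensHom, realizeμ_cov,
      tensorHom_comp_tensorHom_assoc, realizeMap_cov, realizeMap_cov]

theorem realizeμ_assoc (hF : G.Extracts S.F) (f g h : S.Obj) :
    (α_ (G.realizeObj f) (G.realizeObj g) (G.realizeObj h)).inv ≫
      (realizeμ hX f g ▷ G.realizeObj h) ≫ realizeμ hX (tensObj f g) h =
    (G.realizeObj f ◁ realizeμ hX g h) ≫ realizeμ hX f (tensObj g h) ≫
      realizeMap hX (assocIso f g h).hom :=
  cov_tens_hom_ext₃ hX fun a b c e u i j v w z => by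
    have lhs : (realizeμ hX f g ▷ G.realizeObj h) ≫ realizeμ hX (tensObj f g) h ≫
        cov hX _ u (tens e c u j (tens a b e i v w) z) =
        ((cov hX f a v ⊗ₘ cov hX g b w) ⊗ₘ cov hX h c z) ≫ (G.η a b e i ▷ G.X c) ≫ G.η e c u j := by
      rw [realizeμ_cov, ← tensorHom_id, tensorHom_comp_tensorHom_assoc, realizeμ_cov,
        ← tensorHom_id, tensorHom_comp_tensorHom_assoc, Category.id_comp, Category.comp_id]
    have rhs : ∀ (e' : S.L) (i' : Fin (S.N a e' u)) (j' : Fin (S.N b c e')),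
        (G.realizeObj f ◁ realizeμ hX g h) ≫ realizeμ hX f (tensObj g h) ≫
          cov hX _ u (tens a e' u i' v (tens b c e' j' w z)) =
        (cov hX f a v ⊗ₘ (cov hX g b w ⊗ₘ cov hX h c z)) ≫ (G.X a ◁ G.η b c e' j') ≫
          G.η a e' u i' := by
      intro e' i' j'
      rw [realizeμ_cov, ← id_tensorHom, tensorHom_comp_tensorHom_assoc, realizeμ_cov,
        ← id_tensorHom, tensorHom_comp_tensorHom_assoc, Category.id_comp, Category.comp_id]
    simp only [Category.assoc]
    rw [lhs, realizeMap_cov, act_assoc, ← associator_inv_naturality_assoc]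
    refine (congrArg (fun g => _ ≫ g) (hF a b c u e i j)).trans ?_
    simp only [map_sum, map_smul, Preadditive.comp_sum, Linear.comp_smul, rhs]

theorem realizeμ_leftUnitor (f : S.Obj) :
    (λ_ (G.realizeObj f)).hom = (G.realizeε.hom ▷ G.realizeObj f) ≫ realizeμ hX unitObj f ≫
      realizeMap hX (eqToIso (unit_tensObj f)).hom :=
  cov_hom_ext hX fun a v => by
    have i : Fin (S.N S.R.one a a) := ⟨0, N_one_left_pos a⟩
    simp only [Category.assoc]
    rw [realizeMap_cov, act_leftUnitor f i, realizeμ_cov, ← tensorHom_id,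
      tensorHom_comp_tensorHom_assoc, realizeε_cov, Category.id_comp]
    refine Eq.trans ?_ (congrArg (fun g => _ ≫ g) (G.η_left a i).symm)
    rw [← tensorHom_id, tensorHom_comp_tensorHom_assoc, eqToHom_trans, eqToHom_refl,
      Category.comp_id, id_tensorHom, MonoidalCategory.leftUnitor_naturality]

theorem realizeμ_rightUnitor (f : S.Obj) :
    (ρ_ (G.realizeObj f)).hom = (G.realizeObj f ◁ G.realizeε.hom) ≫ realizeμ hX f unitObj ≫
      realizeMap hX (eqToIso (tensObj_unit f)).hom :=
  cov_hom_ext hX fun a v => by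
    have i : Fin (S.N a S.R.one a) := ⟨0, N_one_right_pos a⟩
    simp only [Category.assoc]
    rw [realizeMap_cov, act_rightUnitor f i, realizeμ_cov, ← id_tensorHom,
      tensorHom_comp_tensorHom_assoc, realizeε_cov, Category.id_comp]
    refine Eq.trans ?_ (congrArg (fun g => _ ≫ g) (G.η_right a i).symm)
    rw [← id_tensorHom, tensorHom_comp_tensorHom_assoc, eqToHom_trans, eqToHom_refl,
      Category.comp_id, tensorHom_id, MonoidalCategory.rightUnitor_naturality]

section

attribute [local instance] monoidalCategory

/-- The functor `realize` is monoidal: the associativity constraints agree because the matrices `F`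
are those of `C`. -/
theorem realize_monoidal (hF : G.Extracts S.F) : Nonempty (realize hX).Monoidal := by
  refine ⟨Functor.CoreMonoidal.toMonoidal
    { εIso := G.realizeε
      μIso := fun f g => @asIso _ _ _ _ (realizeμ hX f g) (realizeμ_isIso hX f g)
      μIso_hom_natural_left := fun {f f'} A g => ?_
      μIso_hom_natural_right := fun {g g'} f B => ?_
      associativity := fun f g h => ?_
      left_unitality := realizeμ_leftUnitor hX
      right_unitality := realizeμ_rightUnitor hX }⟩
  · have := realizeμ_natural hX A (𝟙 g)
    rw [realizeMap_id, tensorHom_id] at this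
    exact this
  · have := realizeμ_natural hX (𝟙 f) B
    rw [realizeMap_id, id_tensorHom] at this
    exact this
  · have h₁ := realizeμ_assoc hX hF f g h
    rw [Iso.inv_comp_eq] at h₁
    have h₂ : realizeMap hX (assocIso f g h).hom ≫ realizeMap hX (assocIso f g h).inv = 𝟙 _ := by
      rw [← realizeMap_comp, Iso.hom_inv_id, realizeMap_id]
    have h₃ := congrArg (fun φ => φ ≫ realizeMap hX (assocIso f g h).inv) h₁
    simp only [Category.assoc, h₂, Category.comp_id] at h₃
    exact h₃

end

end FusionGauge

end

theorem proposition3 (k : Type t) [Field k] [CharZero k] :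
    ∃ mon : ∀ S : FusionSystem.{t, w} k, MonoidalCategory S.Obj,
      (∀ S : FusionSystem.{t, w} k,
        (mon S).toMonoidalCategoryStruct = S.monoidalStruct ∧
        IsFusionCategory k S.Obj ∧ Skeletal S.Obj ∧ IsStrictlyUnital S.Obj) ∧
      ∀ (C : Type u) [Category.{v} C] [Preadditive C] [Linear k C] [MonoidalCategory C],
        IsFusionCategory k C →
          (∃ R : FusionRuleData.{w}, Nonempty (FusionGauge k C R)) ∧
          ∀ (R : FusionRuleData.{w}) (G : FusionGauge k C R),
            (∃! F : R.FMatrices k, G.Extracts F) ∧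
            ∀ F : R.FMatrices k, G.Extracts F → ∃ hF : R.IsFusionSystem F,
              ∃ Φ : (FusionSystem.mk R F hF).Obj ⥤ C,
                Φ.IsEquivalence ∧ Φ.Additive ∧ Φ.Linear k ∧ Nonempty Φ.Monoidal := by
  refine ⟨FusionSystem.monoidalCategory, fun S => ⟨rfl, FusionSystem.isFusionCategory S,
    FusionSystem.skeletal, FusionSystem.isStrictlyUnital S⟩, ?_⟩
  intro C _ _ _ _ hC
  have := hC.monoidalPreadditive
  have := hC.monoidalLinear
  have := hC.finite_hom
  have := hC.hasFiniteBiproducts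
  refine ⟨hC.exists_gauge, fun R G => ?_⟩
  have hX := hC.isSimpleFamily G.simple G.eq_of_iso G.exists_iso
  refine ⟨G.existsUnique_extracts hX, fun F hF => ?_⟩
  let S : FusionSystem k := ⟨R, F, FusionGauge.isFusionSystem_of_extracts hF hX⟩
  let G' : FusionGauge k C S.R := G
  exact ⟨S.isFusionSystem, FusionGauge.realize (G := G') hX,
    FusionGauge.realize_isEquivalence (G := G') hX, FusionGauge.realize_additive (G := G') hX,
    FusionGauge.realize_linear (G := G') hX, FusionGauge.realize_monoidal (G := G') hX hF⟩
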